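/- **Conventions.** All manifolds, metrics and scalars are smooth. For a semi-Riemannian manifold of dimension $d$ with metric $g$ let $R$ be its curvature tensor, normalized so that $R=\frac c2\,g\wedge g$ for constant sectional curvature $c$, let $S_{jk}=g^{il}R_{ijkl}$ be its Ricci tensor, $S^2_{ij}=g^{kl}S_{ik}S_{jl}$ and $\kappa=\mathrm{tr}(S)$ its scalar curvature, where $\mathrm{tr}(A)=g^{ij}A_{ij}$. For $(0,2)$ tensors, $(A\wedge E)_{ijkl}=A_{il}E_{jk}+A_{jk}E_{il}-A_{ik}E_{jl}-A_{jl}E_{ik}$. The manifold is *generalized Roter type* if $R$ is a linear combination, with scalars as coefficients, of $g\wedge g$, $g\wedge S$, $S\wedge S$, $g\wedge S^2$, $S\wedge S^2$, $S^2\wedge S^2$; *Roter type* if $R$ is such a combination of $g\wedge g$, $g\wedge S$, $S\wedge S$; *conformally flat* if $R$ is such a combination of $g\wedge g$, $g\wedge S$ (for $d\ge 3$ this is the vanishing of $C=R-\frac1{d-2}g\wedge S+\frac{\kappa}{2(d-1)(d-2)}g\wedge g$); *of constant curvature* if $R=\frac c2\,g\wedge g$ with a real constant $c$; *Einstein* if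 $S=\frac{\kappa}{d}g$; $Ein(2)$ if $S^2,S,g$ satisfy a linear relation whose coefficients are scalars without common zero. **Statement.** Let $(\overline M,\overline g)$ and $(\widetilde M,\widetilde g)$ be connected semi-Riemannian manifolds of dimensions $p\ge1$ and $m=n-p\ge 1$, let $f>0$ be a smooth function on $\overline M$, and let $M=\overline M\times_f\widetilde M$ be the warped product, i.e. $\overline M\times\widetilde M$ with the metric $g=\pi^*\overline g+(f\circ\pi)\,\sigma^*\widetilde g$ ($\pi,\sigma$ the projections). Bars and tildes denote quantities of the base and of the fiber. Put $f_a=\partial_af$ and, on $\overline M$, $$T_{ab}=-\tfrac1{2f}\Big(\overline\nabla_bf_a-\tfrac1{2f}f_af_b\Big),\quad P=\tfrac1{4f^2}\overline g^{ab}f_af_b,\quad Q=f\big(\mathrm{tr}(T)-(m-1)P\big),$$ $T^2_{ab}=\overline g^{cd}T_{ac}T_{db}$, $(\overline S\cdot T)_{ab}=\overline g^{cd}(\overline S_{ac}T_{db}+T_{ac}\overline S_{db})$, $\overline r=\mathrm{tr}(\overline S)$, $\overline{r^{(2)}}=\mathrm{tr}(\overline S^2)$ and $\Theta=m\big(m\,\mathrm{tr}(T^2)+\mathrm{tr}(\overline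 S\cdot T)\big)+\overline{r^{(2)}}$. Suppose that, with scalars $L_1,\dots,L_6$ on $M$, $$R=L_1\,g\wedge g+L_2\,g\wedge S+L_3\,S\wedge S+L_4\,g\wedge S^2+L_5\,S\wedge S^2+L_6\,S^2\wedge S^2,$$ and define on $M$ $$J_1=-\frac{L_5\overline r+2L_6\Theta+L_4p+L_5\,m\,\mathrm{tr}(T)}{f},$$ $$J_2=-\frac1f\Big[2\overline r(fL_3+L_5Q)+(fL_5+4L_6Q)\Theta+p(fL_2+2L_4Q)+2m\,\mathrm{tr}(T)(fL_3+L_5Q)\Big].$$ Then: (i) The fiber $\widetilde M$ is generalized Roter type. (ii) If for some $x\in\overline M$ the function $J_1$ vanishes nowhere on $\{x\}\times\widetilde M$ (in particular, if $J_1$ vanishes nowhere on $M$), then $\widetilde M$ is Roter type and satisfies $Ein(2)$. (iii) If for some $x\in\overline M$, everywhere on $\{x\}\times\widetilde M$, $J_1\neq0$ and $$\frac{J_2^2L_6}{f^2J_1^2}-\frac{J_2(fL_5+4L_6Q)}{f^2J_1}+\frac{2Q(fL_5+2L_6Q)}{f^2}+L_3=0,$$ then $\widetilde M$ is conformally flat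 (and $\widetilde C=0$ if $m\ge 3$). (iv) If for some $x\in\overline M$, everywhere on $\{x\}\times\widetilde M$, $J_1=0$ and $J_2\ne0$, then $\widetilde R=\frac{\mu}2\,\widetilde g\wedge\widetilde g$ for a scalar $\mu$ on $\widetilde M$ and $\widetilde M$ is Einstein; if moreover $m\neq2$, then $\widetilde M$ is of constant curvature. (v) If there are scalars $\alpha,\beta,\gamma$ on $\overline M$, $\alpha$ nowhere zero, with $\alpha T+\beta\overline g+\gamma\overline S=0$, then the base $\overline M$ is generalized Roter type. -/

import Mathlib

open scoped Manifold ContDiff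
open Module

noncomputable section

namespace WarpedGRT

/-! ### Tensor calculus in one coordinate domain

`E` is the coordinate space and `b` the basis of coordinate directions `∂ᵢ`.  A semi-Riemannian
metric is given by its component matrix `g : E → Matrix ι ι ℝ`. -/

section Coordinates

variable {ι E : Type*} [Fintype ι] [DecidableEq ι] [NormedAddCommGroup E] [NormedSpace ℝ E]

/-- The partial derivative `∂ᵢ u`. -/
def pd (b : Basis ι ℝ E) (i : ι) (u : E → ℝ) (z : E) : ℝ := fderiv ℝ u z (b i)

/-- Christoffel symbols
`Γˡᵢⱼ = ½ gˡᵏ (∂ᵢ gₖⱼ + ∂ⱼ gₖᵢ - ∂ₖ gᵢⱼ)` of the Levi-Civita connection. -/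
def christoffel (b : Basis ι ℝ E) (g : E → Matrix ι ι ℝ) (l i j : ι) (z : E) : ℝ :=
  (1 / 2) * ∑ k, (g z)⁻¹ l k *
    (pd b i (fun w => g w k j) z + pd b j (fun w => g w k i) z - pd b k (fun w => g w i j) z)

/-- The curvature tensor
`R_{hijk} = g_{hl} (∂ₖ Γˡᵢⱼ - ∂ⱼ Γˡᵢₖ + Γᵐᵢⱼ Γˡₘₖ - Γᵐᵢₖ Γˡₘⱼ)`. -/
def riem (b : Basis ι ℝ E) (g : E → Matrix ι ι ℝ) (z : E) (h i j k : ι) : ℝ :=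
  ∑ l, g z h l *
    (pd b k (christoffel b g l i j) z - pd b j (christoffel b g l i k) z
      + ∑ m, (christoffel b g m i j z * christoffel b g l m k z
          - christoffel b g m i k z * christoffel b g l m j z))

/-- The Ricci tensor `S_{jk} = g^{il} R_{ijkl}`. -/
def ricci (b : Basis ι ℝ E) (g : E → Matrix ι ι ℝ) (z : E) : Matrix ι ι ℝ :=
  Matrix.of fun j k => ∑ i, ∑ l, (g z)⁻¹ i l * riem b g z i j k l

/-- The second covariant derivative `∇_c u_a = ∂_c ∂_a u - Γᵈ_{ac} ∂_d u` of a function `u`. -/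
def hess (b : Basis ι ℝ E) (g : E → Matrix ι ι ℝ) (u : E → ℝ) (z : E) : Matrix ι ι ℝ :=
  Matrix.of fun a c => pd b c (pd b a u) z - ∑ d, christoffel b g d a c z * pd b d u z

/-- The tensor `T_{ac} = -(1/2f) (∇_c f_a - (1/2f) f_a f_c)`. -/
def tensorT (b : Basis ι ℝ E) (g : E → Matrix ι ι ℝ) (f : E → ℝ) (z : E) : Matrix ι ι ℝ :=
  Matrix.of fun a c =>
    -(1 / (2 * f z)) * (hess b g f z a c - 1 / (2 * f z) * (pd b a f z * pd b c f z))

/-- The scalar `P = (1/4f²) g^{ac} f_a f_c`. -/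
def scalarP (b : Basis ι ℝ E) (g : E → Matrix ι ι ℝ) (f : E → ℝ) (z : E) : ℝ :=
  1 / (4 * f z ^ 2) * ∑ a, ∑ c, (g z)⁻¹ a c * (pd b a f z * pd b c f z)

end Coordinates

/-! ### Algebra of (0,2) tensors at a point, `g` being the matrix of the metric -/

section Algebra

variable {ι : Type*} [Fintype ι] [DecidableEq ι]

/-- The metric trace `g^{ij} A_{ij}`. -/
def tr (g A : Matrix ι ι ℝ) : ℝ := ∑ i, ∑ j, g⁻¹ i j * A i j

/-- The product `g^{kl} A_{ik} B_{lj}` of (0,2) tensors (composition of the associated operators);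
`comp g S S` is the Ricci tensor of level 2. -/
def comp (g A B : Matrix ι ι ℝ) : Matrix ι ι ℝ :=
  Matrix.of fun i j => ∑ k, ∑ l, g⁻¹ k l * (A i k * B l j)

/-- The symmetric product `A · B`, with components `g^{kl} (A_{ik} B_{lj} + B_{ik} A_{lj})`. -/
def symProd (g A B : Matrix ι ι ℝ) : Matrix ι ι ℝ := comp g A B + comp g B A

/-- The Kulkarni–Nomizu product `A ∧ B`. -/
def kn (A B : Matrix ι ι ℝ) (i j k l : ι) : ℝ :=
  A i l * B j k + A j k * B i l - A i k * B j l - A j l * B i k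

end Algebra

/-! ### Semi-Riemannian manifolds

A field of bilinear forms `g` on the tangent spaces of a manifold `M` is read in the charts of the
atlas of `M`.  A tensor identity on `M` is expressed by the identity of the components
in all charts of the atlas. -/

section Manifold

variable {ι E H M : Type*} [Fintype ι] [DecidableEq ι] [NormedAddCommGroup E] [NormedSpace ℝ E]
  [TopologicalSpace H] [TopologicalSpace M] [ChartedSpace H M]

/-- Fields of bilinear forms on the tangent spaces of `M`. -/
abbrev FormField (I : ModelWithCorners ℝ E H) (M : Type*) [TopologicalSpace M]
    [ChartedSpace H M] : Type _ :=
  ∀ q : M, LinearMap.BilinForm ℝ (TangentSpace I q)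

/-- The coordinate vector `∂ᵢ` of the chart `e`, at the point with coordinates `z`. -/
def coordVec (I : ModelWithCorners ℝ E H) (b : Basis ι ℝ E) (e : OpenPartialHomeomorph M H)
    (z : E) (i : ι) : TangentSpace I ((e.extend I).symm z) :=
  mfderiv 𝓘(ℝ, E) I (e.extend I).symm z (b i)

/-- The components `g_{ij} = g(∂ᵢ, ∂ⱼ)` in the chart `e`, as functions of the coordinates. -/
def metricCoord (I : ModelWithCorners ℝ E H) (b : Basis ι ℝ E) (g : FormField I M)
    (e : OpenPartialHomeomorph M H) (z : E) : Matrix ι ι ℝ :=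
  Matrix.of fun i j => g ((e.extend I).symm z) (coordVec I b e z i) (coordVec I b e z j)

/-- `g` is a smooth semi-Riemannian metric: symmetric, nondegenerate, with smooth components. -/
structure IsSemiRiemannian (I : ModelWithCorners ℝ E H) (b : Basis ι ℝ E) (g : FormField I M) :
    Prop where
  symm : ∀ (q : M) (u v : TangentSpace I q), g q u v = g q v u
  nondegenerate : ∀ (q : M) (u : TangentSpace I q), (∀ v : TangentSpace I q, g q u v = 0) → u = 0
  smooth : ∀ e ∈ atlas H M, ∀ i j : ι,
    ContDiffOn ℝ ∞ (fun z => metricCoord I b g e z i j) (e.extend I).target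

/-- Components of the metric in the chart `e` at the point `q`. -/
def gAt (I : ModelWithCorners ℝ E H) (b : Basis ι ℝ E) (g : FormField I M)
    (e : OpenPartialHomeomorph M H) (q : M) : Matrix ι ι ℝ :=
  metricCoord I b g e (e.extend I q)

/-- Components of the curvature tensor `R` in the chart `e` at the point `q`. -/
def rAt (I : ModelWithCorners ℝ E H) (b : Basis ι ℝ E) (g : FormField I M)
    (e : OpenPartialHomeomorph M H) (q : M) : ι → ι → ι → ι → ℝ :=
  riem b (metricCoord I b g e) (e.extend I q)

/-- Components of the Ricci tensor `S` in the chart `e` at the point `q`. -/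
def sAt (I : ModelWithCorners ℝ E H) (b : Basis ι ℝ E) (g : FormField I M)
    (e : OpenPartialHomeomorph M H) (q : M) : Matrix ι ι ℝ :=
  ricci b (metricCoord I b g e) (e.extend I q)

/-- Components of the Ricci tensor of level two `S²` in the chart `e` at the point `q`. -/
def s2At (I : ModelWithCorners ℝ E H) (b : Basis ι ℝ E) (g : FormField I M)
    (e : OpenPartialHomeomorph M H) (q : M) : Matrix ι ι ℝ :=
  comp (gAt I b g e q) (sAt I b g e q) (sAt I b g e q)

/-- The scalar curvature `κ`, computed in the chart `e` at the point `q`. -/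
def scalAt (I : ModelWithCorners ℝ E H) (b : Basis ι ℝ E) (g : FormField I M)
    (e : OpenPartialHomeomorph M H) (q : M) : ℝ :=
  tr (gAt I b g e q) (sAt I b g e q)

/-- The generalized Roter type condition with given associated scalars:
`R = L₁ g∧g + L₂ g∧S + L₃ S∧S + L₄ g∧S² + L₅ S∧S² + L₆ S²∧S²`. -/
def IsGRTWith (I : ModelWithCorners ℝ E H) (b : Basis ι ℝ E) (g : FormField I M)
    (L₁ L₂ L₃ L₄ L₅ L₆ : M → ℝ) : Prop :=
  ∀ e ∈ atlas H M, ∀ q ∈ e.source, ∀ i j k l : ι,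
    rAt I b g e q i j k l =
      L₁ q * kn (gAt I b g e q) (gAt I b g e q) i j k l
      + L₂ q * kn (gAt I b g e q) (sAt I b g e q) i j k l
      + L₃ q * kn (sAt I b g e q) (sAt I b g e q) i j k l
      + L₄ q * kn (gAt I b g e q) (s2At I b g e q) i j k l
      + L₅ q * kn (sAt I b g e q) (s2At I b g e q) i j k l
      + L₆ q * kn (s2At I b g e q) (s2At I b g e q) i j k l

/-- Smooth scalars on `M`. -/
def IsScalar (I : ModelWithCorners ℝ E H) (u : M → ℝ) : Prop := ContMDiff I 𝓘(ℝ, ℝ) ∞ u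

/-- Generalized Roter type manifolds. -/
def IsGRT (I : ModelWithCorners ℝ E H) (b : Basis ι ℝ E) (g : FormField I M) : Prop :=
  ∃ L₁ L₂ L₃ L₄ L₅ L₆ : M → ℝ,
    (IsScalar I L₁ ∧ IsScalar I L₂ ∧ IsScalar I L₃ ∧ IsScalar I L₄ ∧ IsScalar I L₅ ∧
      IsScalar I L₆) ∧ IsGRTWith I b g L₁ L₂ L₃ L₄ L₅ L₆

/-- Roter type manifolds: `R = N₁ g∧g + N₂ g∧S + N₃ S∧S`. -/
def IsRoter (I : ModelWithCorners ℝ E H) (b : Basis ι ℝ E) (g : FormField I M) : Prop :=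
  ∃ N₁ N₂ N₃ : M → ℝ, (IsScalar I N₁ ∧ IsScalar I N₂ ∧ IsScalar I N₃) ∧
    ∀ e ∈ atlas H M, ∀ q ∈ e.source, ∀ i j k l : ι,
      rAt I b g e q i j k l =
        N₁ q * kn (gAt I b g e q) (gAt I b g e q) i j k l
        + N₂ q * kn (gAt I b g e q) (sAt I b g e q) i j k l
        + N₃ q * kn (sAt I b g e q) (sAt I b g e q) i j k l

/-- Conformally flat manifolds, in the sense that `R = N₁ g∧g + N₂ g∧S`. -/
def IsConformallyFlat (I : ModelWithCorners ℝ E H) (b : Basis ι ℝ E) (g : FormField I M) : Prop :=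
  ∃ N₁ N₂ : M → ℝ, (IsScalar I N₁ ∧ IsScalar I N₂) ∧
    ∀ e ∈ atlas H M, ∀ q ∈ e.source, ∀ i j k l : ι,
      rAt I b g e q i j k l =
        N₁ q * kn (gAt I b g e q) (gAt I b g e q) i j k l
        + N₂ q * kn (gAt I b g e q) (sAt I b g e q) i j k l

/-- Vanishing of the conformal curvature tensor
`C = R - (1/(d-2)) g∧S + (κ/(2(d-1)(d-2))) g∧g`; here `d` is the dimension, and the condition is
meaningful for `d ≥ 3`. -/
def WeylVanishes (I : ModelWithCorners ℝ E H) (b : Basis ι ℝ E) (g : FormField I M) : Prop :=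
  ∀ e ∈ atlas H M, ∀ q ∈ e.source, ∀ i j k l : ι,
    rAt I b g e q i j k l
      - 1 / ((Fintype.card ι : ℝ) - 2) * kn (gAt I b g e q) (sAt I b g e q) i j k l
      + scalAt I b g e q / (2 * ((Fintype.card ι : ℝ) - 1) * ((Fintype.card ι : ℝ) - 2))
        * kn (gAt I b g e q) (gAt I b g e q) i j k l = 0

/-- At each point all sectional curvatures coincide: `R = μ G` with a scalar `μ` and the Gaussian
curvature tensor `G = ½ g∧g`. -/
def HasPointwiseConstantCurvature (I : ModelWithCorners ℝ E H) (b : Basis ι ℝ E)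
    (g : FormField I M) : Prop :=
  ∃ μ : M → ℝ, IsScalar I μ ∧ ∀ e ∈ atlas H M, ∀ q ∈ e.source, ∀ i j k l : ι,
    rAt I b g e q i j k l = μ q * (1 / 2 * kn (gAt I b g e q) (gAt I b g e q) i j k l)

/-- Constant curvature: `R = c G` with a real constant `c`. -/
def HasConstantCurvature (I : ModelWithCorners ℝ E H) (b : Basis ι ℝ E)
    (g : FormField I M) : Prop :=
  ∃ c : ℝ, ∀ e ∈ atlas H M, ∀ q ∈ e.source, ∀ i j k l : ι,
    rAt I b g e q i j k l = c * (1 / 2 * kn (gAt I b g e q) (gAt I b g e q) i j k l)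

/-- Einstein manifolds: `S = (κ/d) g`, where `d` is the dimension. -/
def IsEinstein (I : ModelWithCorners ℝ E H) (b : Basis ι ℝ E) (g : FormField I M) : Prop :=
  ∀ e ∈ atlas H M, ∀ q ∈ e.source,
    sAt I b g e q = (scalAt I b g e q / (Fintype.card ι : ℝ)) • gAt I b g e q

/-- The `Ein(2)` condition: `S²`, `S`, `g` are linearly dependent, that is, they satisfy a linear
relation whose coefficients are scalars without common zero. -/
def IsEin2 (I : ModelWithCorners ℝ E H) (b : Basis ι ℝ E) (g : FormField I M) : Prop :=
  ∃ α β γ : M → ℝ, (IsScalar I α ∧ IsScalar I β ∧ IsScalar I γ) ∧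
    (∀ q, α q ≠ 0 ∨ β q ≠ 0 ∨ γ q ≠ 0) ∧
    ∀ e ∈ atlas H M, ∀ q ∈ e.source,
      α q • s2At I b g e q + β q • sAt I b g e q + γ q • gAt I b g e q = 0

/-- Components of `T` (for the function `f` on `M`) in the chart `e` at the point `q`. -/
def tAt (I : ModelWithCorners ℝ E H) (b : Basis ι ℝ E) (g : FormField I M) (f : M → ℝ)
    (e : OpenPartialHomeomorph M H) (q : M) : Matrix ι ι ℝ :=
  tensorT b (metricCoord I b g e) (f ∘ (e.extend I).symm) (e.extend I q)

/-- The scalar `P` (for the function `f` on `M`), computed in the chart `e` at the point `q`. -/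
def pAt (I : ModelWithCorners ℝ E H) (b : Basis ι ℝ E) (g : FormField I M) (f : M → ℝ)
    (e : OpenPartialHomeomorph M H) (q : M) : ℝ :=
  scalarP b (metricCoord I b g e) (f ∘ (e.extend I).symm) (e.extend I q)

/-- `T`, `g`, `S` are linearly dependent with nowhere zero coefficient of `T`. -/
def DependentT (I : ModelWithCorners ℝ E H) (b : Basis ι ℝ E) (g : FormField I M) (f : M → ℝ) :
    Prop :=
  ∃ α β γ : M → ℝ, (IsScalar I α ∧ IsScalar I β ∧ IsScalar I γ) ∧ (∀ q, α q ≠ 0) ∧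
    ∀ e ∈ atlas H M, ∀ q ∈ e.source,
      α q • tAt I b g f e q + β q • gAt I b g e q + γ q • sAt I b g e q = 0

end Manifold

/-! ### Warped products -/

section Warped

variable {ι E H B : Type*} [Fintype ι] [DecidableEq ι] [NormedAddCommGroup E] [NormedSpace ℝ E]
  [TopologicalSpace H] [TopologicalSpace B] [ChartedSpace H B]
  {E' H' F : Type*} [NormedAddCommGroup E'] [NormedSpace ℝ E']
  [TopologicalSpace H'] [TopologicalSpace F] [ChartedSpace H' F]

/-- The pull-back of a field of bilinear forms under a map. -/
def pullback (I : ModelWithCorners ℝ E H) (I' : ModelWithCorners ℝ E' H') (φ : B → F)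
    (g : FormField I' F) : FormField I B :=
  fun q => (g (φ q)).comp (mfderiv I I' φ q).toLinearMap (mfderiv I I' φ q).toLinearMap

/-- The warped product metric `π^* gB + (f ∘ π) σ^* gF` on `B × F`. -/
def warpedMetric (I : ModelWithCorners ℝ E H) (I' : ModelWithCorners ℝ E' H')
    (gB : FormField I B) (gF : FormField I' F) (f : B → ℝ) : FormField (I.prod I') (B × F) :=
  fun q => pullback (I.prod I') I Prod.fst gB q
    + f q.1 • pullback (I.prod I') I' Prod.snd gF q

/-- The trace of `T` at a point of the base. -/
def trT (I : ModelWithCorners ℝ E H) (b : Basis ι ℝ E) (g : FormField I B) (f : B → ℝ)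
    (x : B) : ℝ :=
  tr (gAt I b g (chartAt H x) x) (tAt I b g f (chartAt H x) x)

/-- The scalar `Q = f (tr T - (m - 1) P)` on the base, `m` being the dimension of the fiber; it is
the scalar for which the fiber part of the Ricci tensor of the warped product is the Ricci tensor
of the fiber plus `Q` times the metric of the fiber. -/
def scalarQ (I : ModelWithCorners ℝ E H) (b : Basis ι ℝ E) (g : FormField I B) (f : B → ℝ)
    (m : ℕ) (x : B) : ℝ :=
  f x * (trT I b g f x - ((m : ℝ) - 1) * pAt I b g f (chartAt H x) x)

/-- The scalar curvature `r` of the base. -/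
def rBase (I : ModelWithCorners ℝ E H) (b : Basis ι ℝ E) (g : FormField I B) (x : B) : ℝ :=
  scalAt I b g (chartAt H x) x

/-- The bracket `m (m tr(T²) + tr(S·T)) + r⁽²⁾` at a point of the base, where `r⁽²⁾ = tr(S²)`. -/
def bracketBase (I : ModelWithCorners ℝ E H) (b : Basis ι ℝ E) (g : FormField I B) (f : B → ℝ)
    (m : ℕ) (x : B) : ℝ :=
  (m : ℝ) * ((m : ℝ) * tr (gAt I b g (chartAt H x) x)
          (comp (gAt I b g (chartAt H x) x) (tAt I b g f (chartAt H x) x)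
            (tAt I b g f (chartAt H x) x))
      + tr (gAt I b g (chartAt H x) x)
          (symProd (gAt I b g (chartAt H x) x) (sAt I b g (chartAt H x) x)
            (tAt I b g f (chartAt H x) x)))
    + tr (gAt I b g (chartAt H x) x) (s2At I b g (chartAt H x) x)

/-- The scalar `J₁` on the warped product. -/
def J1 (I : ModelWithCorners ℝ E H) (b : Basis ι ℝ E) (g : FormField I B) (f : B → ℝ) (m : ℕ)
    (L₄ L₅ L₆ : B × F → ℝ) (q : B × F) : ℝ :=
  -((L₅ q * rBase I b g q.1 + 2 * L₆ q * bracketBase I b g f m q.1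
      + L₄ q * (Fintype.card ι : ℝ) + L₅ q * trT I b g f q.1 * (m : ℝ)) / f q.1)

/-- The scalar `J₂` on the warped product. -/
def J2 (I : ModelWithCorners ℝ E H) (b : Basis ι ℝ E) (g : FormField I B) (f : B → ℝ) (m : ℕ)
    (L₂ L₃ L₄ L₅ L₆ : B × F → ℝ) (q : B × F) : ℝ :=
  -(1 / f q.1) *
    (2 * rBase I b g q.1 * (f q.1 * L₃ q + L₅ q * scalarQ I b g f m q.1)
      + (f q.1 * L₅ q + 4 * L₆ q * scalarQ I b g f m q.1) * bracketBase I b g f m q.1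
      + (Fintype.card ι : ℝ) * (f q.1 * L₂ q + 2 * L₄ q * scalarQ I b g f m q.1)
      + 2 * trT I b g f q.1 * (m : ℝ) * (f q.1 * L₃ q + L₅ q * scalarQ I b g f m q.1))

end Warped

/-- The standard basis of `ℝᵈ`. -/
abbrev stdBasis (d : ℕ) : Basis (Fin d) ℝ (EuclideanSpace ℝ (Fin d)) :=
  (EuclideanSpace.basisFun (Fin d) ℝ).toBasis

end WarpedGRT

end

/-!
In product charts the mixed components `R_{aβγd}` of the curvature tensor of a warped product are
`f g̃_{βγ} T_{ad}`, and its Ricci tensor is block diagonal, with blocks `S̄ + m T` and `S̃ + Q g̃`.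
So the mixed components of the hypothesis on `R`, traced over the base indices, become a relation
`J₁ S̃² + J₂ S̃ + J₃ g̃ = 0` on each fiber, while its fiber components are a generalized Roter
type expression for `R̃`, the contribution `½ f² P g̃∧g̃` of the warping function being absorbed in
the first coefficient. Solving the relation for `S̃²` when `J₁ ≠ 0`, or for `S̃` when
`J₁ = 0 ≠ J₂`, eliminates terms of this expression; in the second case Schur's lemma makes the
curvature constant in dimension at least `3`. On the base, `α T + β ḡ + γ S̄ = 0` makes `S̄ + m T` a
combination of `S̄` and `ḡ`.
-/

noncomputable section

namespace WarpedGRT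

/-! ### The Levi-Civita connection in coordinates -/

section PartialDerivatives

variable {ι E : Type*} [NormedAddCommGroup E] [NormedSpace ℝ E] (b : Basis ι ℝ E) {s : Set E}
  {u v : E → ℝ} {z : E}

theorem contDiffOn_pd (hs : IsOpen s) (hu : ContDiffOn ℝ ∞ u s) (i : ι) :
    ContDiffOn ℝ ∞ (pd b i u) s :=
  (hu.fderiv_of_isOpen hs (by simp)).clm_apply contDiffOn_const

theorem differentiableAt_of_contDiffOn (hs : IsOpen s) (hu : ContDiffOn ℝ ∞ u s) (hz : z ∈ s) :
    DifferentiableAt ℝ u z :=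
  (hu.contDiffAt (hs.mem_nhds hz)).differentiableAt (by simp)

theorem pd_congr_of_eventuallyEq (h : u =ᶠ[nhds z] v) (i : ι) : pd b i u z = pd b i v z := by
  simp only [pd, h.fderiv_eq]

theorem pd_congr (hs : IsOpen s) (h : Set.EqOn u v s) (hz : z ∈ s) (i : ι) :
    pd b i u z = pd b i v z :=
  pd_congr_of_eventuallyEq b (h.eventuallyEq_of_mem (hs.mem_nhds hz)) i

theorem pd_const (c : ℝ) (i : ι) : pd b i (fun _ => c) z = 0 := by
  simp [pd]

theorem pd_add (hu : DifferentiableAt ℝ u z) (hv : DifferentiableAt ℝ v z) (i : ι) :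
    pd b i (fun w => u w + v w) z = pd b i u z + pd b i v z := by
  simp [pd, fderiv_fun_add hu hv]

theorem pd_sub (hu : DifferentiableAt ℝ u z) (hv : DifferentiableAt ℝ v z) (i : ι) :
    pd b i (fun w => u w - v w) z = pd b i u z - pd b i v z := by
  simp [pd, fderiv_fun_sub hu hv]

theorem pd_mul (hu : DifferentiableAt ℝ u z) (hv : DifferentiableAt ℝ v z) (i : ι) :
    pd b i (fun w => u w * v w) z = pd b i u z * v z + u z * pd b i v z := by
  simp only [pd, fderiv_fun_mul hu hv, add_apply, smul_apply, smul_eq_mul]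
  ring

theorem pd_const_mul (c : ℝ) (hu : DifferentiableAt ℝ u z) (i : ι) :
    pd b i (fun w => c * u w) z = c * pd b i u z := by
  simp [pd, fderiv_const_mul hu]

theorem pd_inv (hu : DifferentiableAt ℝ u z) (hz : u z ≠ 0) (i : ι) :
    pd b i (fun w => (u w)⁻¹) z = -pd b i u z / u z ^ 2 := by
  have := ((hasDerivAt_inv hz).comp_hasFDerivAt z hu.hasFDerivAt).fderiv
  simp only [pd, Function.comp_def] at this ⊢
  rw [this, smul_apply, smul_eq_mul]
  ring

theorem pd_sum {κ : Type*} [Fintype κ] {u : κ → E → ℝ} (hu : ∀ k, DifferentiableAt ℝ (u k) z)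
    (i : ι) : pd b i (fun w => ∑ k, u k w) z = ∑ k, pd b i (u k) z := by
  simp [pd, fderiv_fun_sum fun k _ => hu k]

theorem pd_comm (hs : IsOpen s) (hu : ContDiffOn ℝ ∞ u s) (hz : z ∈ s) (i j : ι) :
    pd b i (pd b j u) z = pd b j (pd b i u) z := by
  have hd : DifferentiableAt ℝ (fderiv ℝ u) z :=
    ((hu.fderiv_of_isOpen (m := ∞) hs (by simp)).contDiffAt
      (hs.mem_nhds hz)).differentiableAt (by simp)
  have pd_pd (i j : ι) : pd b i (pd b j u) z = fderiv ℝ (fderiv ℝ u) z (b i) (b j) := by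
    have := (hd.hasFDerivAt.clm_apply (hasFDerivAt_const (b j) z)).fderiv
    change fderiv ℝ (fun w => fderiv ℝ u w (b j)) z (b i) = _
    simp [this]
  rw [pd_pd, pd_pd]
  exact ((hu.contDiffAt (hs.mem_nhds hz)).isSymmSndFDerivAt
    (by simpa using WithTop.coe_le_coe.2 (le_top : (2 : ℕ∞) ≤ ⊤))) _ _

end PartialDerivatives

section Connections

variable {ι κ E : Type*} [Fintype κ] [NormedAddCommGroup E] [NormedSpace ℝ E]

/-- The entrywise partial derivative of a matrix-valued function. -/
def pdMatrix (b : Basis ι ℝ E) (i : ι) (A : E → Matrix κ κ ℝ) (z : E) : Matrix κ κ ℝ :=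
  Matrix.of fun p q => pd b i (fun w => A w p q) z

/-- The curvature `∂ₖ Aⱼ - ∂ⱼ Aₖ + [Aₖ, Aⱼ]` of the connection on a trivial bundle with connection
matrices `Aᵢ`. -/
def curvForm (b : Basis ι ℝ E) (A : ι → E → Matrix κ κ ℝ) (j k : ι) (z : E) : Matrix κ κ ℝ :=
  pdMatrix b k (A j) z - pdMatrix b j (A k) z + (A k z * A j z - A j z * A k z)

/-- The covariant derivative `∂ₙ W + [Aₙ, W]` of a field of endomorphisms of the trivial bundle
with connection matrices `Aᵢ`. -/
def covDeriv (b : Basis ι ℝ E) (A : ι → E → Matrix κ κ ℝ) (n : ι) (W : E → Matrix κ κ ℝ) (z : E) :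
    Matrix κ κ ℝ :=
  pdMatrix b n W z + (A n z * W z - W z * A n z)

variable (b : Basis ι ℝ E) {s : Set E} {z : E}

theorem pdMatrix_mul {U V : E → Matrix κ κ ℝ}
    (hU : ∀ p q, DifferentiableAt ℝ (fun w => U w p q) z)
    (hV : ∀ p q, DifferentiableAt ℝ (fun w => V w p q) z) (i : ι) :
    pdMatrix b i (fun w => U w * V w) z = pdMatrix b i U z * V z + U z * pdMatrix b i V z := by
  ext p q
  simp only [pdMatrix, Matrix.mul_apply, Matrix.add_apply, Matrix.of_apply]
  rw [pd_sum b fun k => (hU p k).fun_mul (hV k q), ← Finset.sum_add_distrib]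
  exact Finset.sum_congr rfl fun k _ => pd_mul b (hU p k) (hV k q) i

theorem pdMatrix_curvForm {A : ι → E → Matrix κ κ ℝ} (hs : IsOpen s)
    (hA : ∀ j p q, ContDiffOn ℝ ∞ (fun w => A j w p q) s) (hz : z ∈ s) (n j k : ι) :
    pdMatrix b n (curvForm b A j k) z =
      pdMatrix b n (pdMatrix b k (A j)) z - pdMatrix b n (pdMatrix b j (A k)) z
      + (pdMatrix b n (A k) z * A j z + A k z * pdMatrix b n (A j) z
        - (pdMatrix b n (A j) z * A k z + A j z * pdMatrix b n (A k) z)) := by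
  have dA (j : ι) (p q : κ) : DifferentiableAt ℝ (fun w => A j w p q) z :=
    differentiableAt_of_contDiffOn hs (hA j p q) hz
  have ddA (k j : ι) (p q : κ) : DifferentiableAt ℝ (fun w => pdMatrix b k (A j) w p q) z :=
    differentiableAt_of_contDiffOn hs (contDiffOn_pd b hs (hA j p q) k) hz
  have dAA (k j : ι) (p q : κ) : DifferentiableAt ℝ (fun w => (A k w * A j w) p q) z := by
    simp only [Matrix.mul_apply]
    exact DifferentiableAt.fun_sum fun m _ => (dA k p m).fun_mul (dA j m q)
  rw [← pdMatrix_mul b (dA k) (dA j), ← pdMatrix_mul b (dA j) (dA k)]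
  ext p q
  exact (pd_add b ((ddA k j p q).fun_sub (ddA j k p q)) ((dAA k j p q).fun_sub (dAA j k p q))
    n).trans (congrArg₂ (· + ·) (pd_sub b (ddA k j p q) (ddA j k p q) n)
      (pd_sub b (dAA k j p q) (dAA j k p q) n))

theorem second_bianchi {A : ι → E → Matrix κ κ ℝ} (hs : IsOpen s)
    (hA : ∀ j p q, ContDiffOn ℝ ∞ (fun w => A j w p q) s) (hz : z ∈ s) (n j k : ι) :
    covDeriv b A n (curvForm b A j k) z + covDeriv b A j (curvForm b A k n) z
      + covDeriv b A k (curvForm b A n j) z = 0 := by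
  have pdMatrix_comm (i j k : ι) :
      pdMatrix b i (pdMatrix b j (A k)) z = pdMatrix b j (pdMatrix b i (A k)) z := by
    ext p q
    exact pd_comm b hs (hA k p q) hz i j
  simp only [covDeriv, pdMatrix_curvForm b hs hA hz]
  rw [pdMatrix_comm n k j, pdMatrix_comm j n k, pdMatrix_comm k j n]
  simp only [curvForm]
  noncomm_ring

end Connections

section LeviCivita

variable {ι E : Type*} [Fintype ι] [DecidableEq ι] [NormedAddCommGroup E] [NormedSpace ℝ E]

/-- A semi-Riemannian metric in coordinates ranging over the open set `s`, given by its matrix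
of components. -/
structure IsMetricOn (g : E → Matrix ι ι ℝ) (s : Set E) : Prop where
  isOpen : IsOpen s
  smooth : ∀ i j, ContDiffOn ℝ ∞ (fun z => g z i j) s
  symm : ∀ z ∈ s, (g z).IsSymm
  isUnit : ∀ z ∈ s, IsUnit (g z).det

/-- The curvature tensor with its first index raised, `Rˡᵢⱼₖ = gˡʰ R_{hijk}`. -/
def curvOp (b : Basis ι ℝ E) (g : E → Matrix ι ι ℝ) (z : E) (l i j k : ι) : ℝ :=
  pd b k (christoffel b g l i j) z - pd b j (christoffel b g l i k) z
    + ∑ m, (christoffel b g m i j z * christoffel b g l m k z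
        - christoffel b g m i k z * christoffel b g l m j z)

theorem riem_eq_sum_curvOp (b : Basis ι ℝ E) (g : E → Matrix ι ι ℝ) (z : E) (h i j k : ι) :
    riem b g z h i j k = ∑ l, g z h l * curvOp b g z l i j k := rfl

theorem riem_swap (b : Basis ι ℝ E) (g : E → Matrix ι ι ℝ) (z : E) (h i j k : ι) :
    riem b g z h i j k = -riem b g z h i k j := by
  rw [riem, riem, ← Finset.sum_neg_distrib]
  refine Finset.sum_congr rfl fun l _ => ?_
  simp only [Finset.sum_sub_distrib]
  ring

/-- The connection matrices `(Γˡᵢⱼ)_{l i}` of the Levi-Civita connection. -/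
def connForm (b : Basis ι ℝ E) (g : E → Matrix ι ι ℝ) (j : ι) (z : E) : Matrix ι ι ℝ :=
  Matrix.of fun l i => christoffel b g l i j z

theorem curvForm_connForm_apply (b : Basis ι ℝ E) (g : E → Matrix ι ι ℝ) (j k : ι) (z : E)
    (l i : ι) : curvForm b (connForm b g) j k z l i = curvOp b g z l i j k := by
  simp only [curvForm, connForm, pdMatrix, curvOp, Matrix.add_apply, Matrix.sub_apply,
    Matrix.mul_apply, Matrix.of_apply, Finset.sum_sub_distrib,
    mul_comm (christoffel b g _ i _ z)]

namespace IsMetricOn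

variable {g : E → Matrix ι ι ℝ} {s : Set E} {z : E}

theorem inv_mul (h : IsMetricOn g s) (hz : z ∈ s) (i j : ι) :
    ∑ k, (g z)⁻¹ i k * g z k j = if i = j then 1 else 0 := by
  rw [← Matrix.mul_apply, Matrix.nonsing_inv_mul _ (h.isUnit z hz), Matrix.one_apply]

theorem inv_symm (h : IsMetricOn g s) (hz : z ∈ s) : (g z)⁻¹.IsSymm := by
  rw [Matrix.IsSymm, Matrix.transpose_nonsing_inv, h.symm z hz]

theorem lower_raise (h : IsMetricOn g s) (hz : z ∈ s) (v : ι → ℝ) (k : ι) :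
    ∑ l, g z k l * ∑ n, (g z)⁻¹ l n * v n = v k := by
  change (g z).mulVec ((g z)⁻¹.mulVec v) k = v k
  rw [Matrix.mulVec_mulVec, Matrix.mul_nonsing_inv _ (h.isUnit z hz), Matrix.one_mulVec]

theorem raise_lower (h : IsMetricOn g s) (hz : z ∈ s) (v : ι → ℝ) (k : ι) :
    ∑ l, (g z)⁻¹ k l * ∑ n, g z l n * v n = v k := by
  change (g z)⁻¹.mulVec ((g z).mulVec v) k = v k
  rw [Matrix.mulVec_mulVec, Matrix.nonsing_inv_mul _ (h.isUnit z hz), Matrix.one_mulVec]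

theorem differentiableAt (h : IsMetricOn g s) (hz : z ∈ s) (i j : ι) :
    DifferentiableAt ℝ (fun w => g w i j) z :=
  differentiableAt_of_contDiffOn h.isOpen (h.smooth i j) hz

theorem smooth_inv (h : IsMetricOn g s) (i j : ι) : ContDiffOn ℝ ∞ (fun z => (g z)⁻¹ i j) s := by
  have hdet : ContDiffOn ℝ ∞ (fun z => (g z).det) s := by
    simp only [Matrix.det_apply]
    exact ContDiffOn.sum fun σ _ => (contDiffOn_prod fun k _ => h.smooth _ _).const_smul _
  have hadj : ContDiffOn ℝ ∞ (fun z => (g z).adjugate i j) s := by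
    simp only [Matrix.adjugate_apply, Matrix.det_apply]
    refine ContDiffOn.sum fun σ _ => (contDiffOn_prod fun k _ => ?_).const_smul _
    by_cases hk : σ k = j
    · simp only [hk, Matrix.updateRow_self]
      exact contDiffOn_const
    · simp only [Matrix.updateRow_ne hk]
      exact h.smooth _ _
  simp only [Matrix.inv_def, Ring.inverse_eq_inv', Matrix.smul_apply, smul_eq_mul]
  exact (hdet.inv fun z hz => (h.isUnit z hz).ne_zero).mul hadj

theorem smooth_christoffel (h : IsMetricOn g s) (b : Basis ι ℝ E) (l i j : ι) :
    ContDiffOn ℝ ∞ (christoffel b g l i j) s := by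
  unfold christoffel
  refine contDiffOn_const.mul (ContDiffOn.sum fun k _ => (h.smooth_inv l k).mul ?_)
  exact ((contDiffOn_pd b h.isOpen (h.smooth k j) i).add
    (contDiffOn_pd b h.isOpen (h.smooth k i) j)).sub (contDiffOn_pd b h.isOpen (h.smooth i j) k)

theorem differentiableAt_christoffel (h : IsMetricOn g s) (b : Basis ι ℝ E) (l i j : ι)
    (hz : z ∈ s) : DifferentiableAt ℝ (christoffel b g l i j) z :=
  differentiableAt_of_contDiffOn h.isOpen (h.smooth_christoffel b l i j) hz

theorem pd_symm (h : IsMetricOn g s) (b : Basis ι ℝ E) (hz : z ∈ s) (i j k : ι) :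
    pd b k (fun w => g w i j) z = pd b k (fun w => g w j i) z :=
  pd_congr b h.isOpen (fun w hw => (h.symm w hw).apply j i) hz k

theorem christoffel_symm (h : IsMetricOn g s) (b : Basis ι ℝ E) (hz : z ∈ s) (l i j : ι) :
    christoffel b g l i j z = christoffel b g l j i z := by
  unfold christoffel
  congr 1
  refine Finset.sum_congr rfl fun k _ => ?_
  rw [h.pd_symm b hz i j k]
  ring

theorem sum_mul_christoffel (h : IsMetricOn g s) (b : Basis ι ℝ E) (hz : z ∈ s) (k i j : ι) :
    ∑ l, g z k l * christoffel b g l i j z = 1 / 2 *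
      (pd b i (fun w => g w k j) z + pd b j (fun w => g w k i) z
        - pd b k (fun w => g w i j) z) := by
  rw [← h.lower_raise hz (fun k => pd b i (fun w => g w k j) z + pd b j (fun w => g w k i) z
        - pd b k (fun w => g w i j) z) k, Finset.mul_sum]
  refine Finset.sum_congr rfl fun l _ => ?_
  simp only [christoffel]
  ring

theorem pd_metric (h : IsMetricOn g s) (b : Basis ι ℝ E) (hz : z ∈ s) (k i j : ι) :
    pd b k (fun w => g w i j) z =
      ∑ l, g z i l * christoffel b g l j k z + ∑ l, g z j l * christoffel b g l i k z := by
  rw [h.sum_mul_christoffel b hz, h.sum_mul_christoffel b hz, h.pd_symm b hz j i k]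
  ring

theorem pdMatrix_metric (h : IsMetricOn g s) (b : Basis ι ℝ E) (hz : z ∈ s) (k : ι) :
    pdMatrix b k g z = g z * connForm b g k z + (g z * connForm b g k z).transpose := by
  ext i j
  exact h.pd_metric b hz k i j

theorem pdMatrix_metric_mul_connForm (h : IsMetricOn g s) (b : Basis ι ℝ E) (hz : z ∈ s)
    (j k : ι) :
    pdMatrix b k (fun w => g w * connForm b g j w) z
      = (g z * connForm b g k z + (g z * connForm b g k z).transpose) * connForm b g j z
        + g z * pdMatrix b k (connForm b g j) z := by
  rw [pdMatrix_mul b (V := connForm b g j) (h.differentiableAt hz)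
    (fun p q => h.differentiableAt_christoffel b p q j hz), h.pdMatrix_metric b hz]

theorem pdMatrix_pdMatrix_metric (h : IsMetricOn g s) (b : Basis ι ℝ E) (hz : z ∈ s) (j k : ι) :
    pdMatrix b k (pdMatrix b j g) z = pdMatrix b k (fun w => g w * connForm b g j w) z
      + (pdMatrix b k (fun w => g w * connForm b g j w) z).transpose := by
  have d (p q : ι) : DifferentiableAt ℝ (fun w => (g w * connForm b g j w) p q) z := by
    simp only [Matrix.mul_apply]
    exact DifferentiableAt.fun_sum fun m _ =>
      (h.differentiableAt hz p m).fun_mul (h.differentiableAt_christoffel b m q j hz)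
  ext p q
  exact (pd_congr b h.isOpen (fun w hw => h.pd_metric b hw j p q) hz k).trans
    (pd_add b (d p q) (d q p) k)

theorem riem_antisymm (h : IsMetricOn g s) (b : Basis ι ℝ E) (hz : z ∈ s) (i j k l : ι) :
    riem b g z i j k l = -riem b g z j i k l := by
  have riem_apply (i j : ι) :
      riem b g z i j k l = (g z * curvForm b (connForm b g) k l z) i j := by
    simp only [riem_eq_sum_curvOp, Matrix.mul_apply, curvForm_connForm_apply]
  have comm : pdMatrix b l (pdMatrix b k g) z = pdMatrix b k (pdMatrix b l g) z := by
    ext p q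
    exact pd_comm b h.isOpen (h.smooth p q) hz l k
  rw [h.pdMatrix_pdMatrix_metric b hz, h.pdMatrix_pdMatrix_metric b hz,
    h.pdMatrix_metric_mul_connForm b hz, h.pdMatrix_metric_mul_connForm b hz] at comm
  have skew : g z * curvForm b (connForm b g) k l z
      + (g z * curvForm b (connForm b g) k l z).transpose = 0 := by
    rw [← sub_eq_zero] at comm
    rw [← comm, curvForm]
    simp only [Matrix.transpose_mul, Matrix.transpose_add, Matrix.transpose_sub,
      Matrix.transpose_transpose, (h.symm z hz).eq]
    noncomm_ring
  rw [riem_apply, riem_apply]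
  exact eq_neg_of_add_eq_zero_left (congrFun₂ skew i j)

theorem raise_riem (h : IsMetricOn g s) (b : Basis ι ℝ E) (hz : z ∈ s) (l i j k : ι) :
    ∑ n, (g z)⁻¹ l n * riem b g z n i j k = curvOp b g z l i j k :=
  h.raise_lower hz (fun q => curvOp b g z q i j k) l

theorem ricci_eq (h : IsMetricOn g s) (b : Basis ι ℝ E) (hz : z ∈ s) (j k : ι) :
    ricci b g z j k = ∑ l, curvOp b g z l j k l := by
  simp only [ricci, Matrix.of_apply]
  rw [Finset.sum_comm]
  refine Finset.sum_congr rfl fun l _ => ?_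
  rw [← h.raise_riem b hz]
  exact Finset.sum_congr rfl fun i _ => by rw [(h.inv_symm hz).apply l i]

end IsMetricOn

end LeviCivita

/-! ### Schur's lemma -/

section Schur

variable {ι E : Type*} [Fintype ι] [DecidableEq ι] [NormedAddCommGroup E] [NormedSpace ℝ E]

theorem half_kn_self {ι : Type*} (A : Matrix ι ι ℝ) (i j k l : ι) :
    1 / 2 * kn A A i j k l = A i l * A j k - A i k * A j l := by
  simp only [kn]
  ring

namespace IsMetricOn

variable {g : E → Matrix ι ι ℝ} {s : Set E} {z : E} {b : Basis ι ℝ E} {μ : E → ℝ}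

theorem curvOp_of_pointwise_constant (h : IsMetricOn g s)
    (hR : ∀ z ∈ s, ∀ i j k l, riem b g z i j k l = μ z * (1 / 2 * kn (g z) (g z) i j k l))
    (hz : z ∈ s) (l i j k : ι) :
    curvOp b g z l i j k =
      μ z * ((if l = k then 1 else 0) * g z i j - (if l = j then 1 else 0) * g z i k) := by
  rw [← h.raise_riem b hz, ← h.inv_mul hz l k, ← h.inv_mul hz l j, Finset.sum_mul,
    Finset.sum_mul, ← Finset.sum_sub_distrib, Finset.mul_sum]
  refine Finset.sum_congr rfl fun m _ => ?_
  rw [hR z hz, half_kn_self]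
  ring

theorem pd_curvOp_of_pointwise_constant (h : IsMetricOn g s) (hμ : ContDiffOn ℝ ∞ μ s)
    (hR : ∀ z ∈ s, ∀ i j k l, riem b g z i j k l = μ z * (1 / 2 * kn (g z) (g z) i j k l))
    (hz : z ∈ s) (n l i j k : ι) :
    pd b n (fun w => curvOp b g w l i j k) z =
      pd b n μ z * ((if l = k then 1 else 0) * g z i j - (if l = j then 1 else 0) * g z i k)
      + μ z * ((if l = k then 1 else 0) * pd b n (fun w => g w i j) z
        - (if l = j then 1 else 0) * pd b n (fun w => g w i k) z) := by
  have dg (i j : ι) := h.differentiableAt hz i j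
  have dcg (c : ℝ) (i j : ι) : DifferentiableAt ℝ (fun w => c * g w i j) z :=
    (dg i j).const_mul c
  rw [pd_congr b h.isOpen (fun w hw => h.curvOp_of_pointwise_constant hR hw l i j k) hz,
    pd_mul b (differentiableAt_of_contDiffOn h.isOpen hμ hz) ((dcg _ _ _).fun_sub (dcg _ _ _)),
    pd_sub b (dcg _ _ _) (dcg _ _ _), pd_const_mul b _ (dg i j), pd_const_mul b _ (dg i k)]

theorem covDeriv_curvForm_of_pointwise_constant (h : IsMetricOn g s) (hμ : ContDiffOn ℝ ∞ μ s)
    (hR : ∀ z ∈ s, ∀ i j k l, riem b g z i j k l = μ z * (1 / 2 * kn (g z) (g z) i j k l))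
    (hz : z ∈ s) (n j k l i : ι) :
    covDeriv b (connForm b g) n (curvForm b (connForm b g) j k) z l i =
      pd b n μ z * ((if l = k then 1 else 0) * g z i j - (if l = j then 1 else 0) * g z i k)
      + μ z * ((if l = k then 1 else 0) * ∑ m, g z i m * christoffel b g m j n z
        - (if l = j then 1 else 0) * ∑ m, g z i m * christoffel b g m k n z
        + christoffel b g l k n z * g z i j - christoffel b g l j n z * g z i k) := by
  have conn_mul_curv : (connForm b g n z * curvForm b (connForm b g) j k z) l i =
      μ z * (christoffel b g l k n z * g z i j - christoffel b g l j n z * g z i k) := by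
    simp only [Matrix.mul_apply, curvForm_connForm_apply, h.curvOp_of_pointwise_constant hR hz,
      connForm, Matrix.of_apply, mul_left_comm _ (μ z), mul_sub, ← mul_assoc, mul_ite, mul_one,
      mul_zero, ite_mul, zero_mul, Finset.sum_sub_distrib, Finset.sum_ite_eq', Finset.mem_univ,
      if_true]
  have curv_mul_conn : (curvForm b (connForm b g) j k z * connForm b g n z) l i =
      μ z * ((if l = k then 1 else 0) * ∑ m, g z j m * christoffel b g m i n z
        - (if l = j then 1 else 0) * ∑ m, g z k m * christoffel b g m i n z) := by
    simp only [Matrix.mul_apply, curvForm_connForm_apply, h.curvOp_of_pointwise_constant hR hz,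
      connForm, Matrix.of_apply, Finset.mul_sum, ← Finset.sum_sub_distrib]
    refine Finset.sum_congr rfl fun m _ => ?_
    rw [(h.symm z hz).apply j m, (h.symm z hz).apply k m]
    ring
  simp only [covDeriv, Matrix.add_apply, Matrix.sub_apply, conn_mul_curv, curv_mul_conn, pdMatrix,
    Matrix.of_apply, curvForm_connForm_apply, h.pd_curvOp_of_pointwise_constant hμ hR hz,
    h.pd_metric b hz]
  ring

theorem pd_mul_metric_comm_of_pointwise_constant (h : IsMetricOn g s) (hμ : ContDiffOn ℝ ∞ μ s)
    (hR : ∀ z ∈ s, ∀ i j k l, riem b g z i j k l = μ z * (1 / 2 * kn (g z) (g z) i j k l))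
    (hz : z ∈ s) (hι : 3 ≤ Fintype.card ι) (n j i : ι) :
    pd b n μ z * g z i j = pd b j μ z * g z i n := by
  obtain ⟨k, hk⟩ : ∃ k, k ∉ ({n, j} : Finset ι) := by
    simpa using Finset.exists_mem_notMem_of_card_lt_card (s := {n, j}) (t := Finset.univ)
      (Finset.card_le_two.trans_lt (by rwa [Finset.card_univ]))
  obtain ⟨hkn, hkj⟩ : k ≠ n ∧ k ≠ j := by simpa using hk
  have bianchi := congrFun₂ (second_bianchi b h.isOpen (A := connForm b g)
    (fun j p q => h.smooth_christoffel b p q j) hz n j k) k i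
  simp only [Matrix.add_apply, h.covDeriv_curvForm_of_pointwise_constant hμ hR hz, hkn, hkj,
    if_true, if_false, Matrix.zero_apply] at bianchi
  rw [h.christoffel_symm b hz k n k, h.christoffel_symm b hz k j k,
    h.christoffel_symm b hz k n j] at bianchi
  simp only [h.christoffel_symm b hz _ n j] at bianchi
  linear_combination bianchi

theorem schur (h : IsMetricOn g s) (hμ : ContDiffOn ℝ ∞ μ s)
    (hR : ∀ z ∈ s, ∀ i j k l, riem b g z i j k l = μ z * (1 / 2 * kn (g z) (g z) i j k l))
    (hz : z ∈ s) (hι : 3 ≤ Fintype.card ι) (n : ι) : pd b n μ z = 0 := by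
  obtain ⟨j, hjn⟩ : ∃ j, j ≠ n := Fintype.exists_ne_of_one_lt_card (by omega) n
  calc pd b n μ z = pd b n μ z * ∑ i, (g z)⁻¹ j i * g z i j := by
        rw [h.inv_mul hz, if_pos rfl, mul_one]
    _ = pd b j μ z * ∑ i, (g z)⁻¹ j i * g z i n := by
        simp only [Finset.mul_sum, mul_left_comm (pd b _ μ z),
          h.pd_mul_metric_comm_of_pointwise_constant hμ hR hz hι n j]
    _ = 0 := by rw [h.inv_mul hz, if_neg hjn, mul_zero]

end IsMetricOn

end Schur

/-! ### Curvature of a warped product in product coordinates -/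

section ProductBasis

open Sum

variable {ι E ι' E' : Type*} [NormedAddCommGroup E] [NormedSpace ℝ E] [NormedAddCommGroup E']
  [NormedSpace ℝ E'] (b : Basis ι ℝ E) (b' : Basis ι' ℝ E') {u : E → ℝ} {v : E' → ℝ} {z : E × E'}

theorem fderiv_comp_fst_apply (hu : DifferentiableAt ℝ u z.1) (x : E × E') :
    fderiv ℝ (fun w : E × E' => u w.1) z x = fderiv ℝ u z.1 x.1 :=
  DFunLike.congr_fun (hu.hasFDerivAt.comp z hasFDerivAt_fst).fderiv x

theorem fderiv_comp_snd_apply (hv : DifferentiableAt ℝ v z.2) (x : E × E') :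
    fderiv ℝ (fun w : E × E' => v w.2) z x = fderiv ℝ v z.2 x.2 :=
  DFunLike.congr_fun (hv.hasFDerivAt.comp z hasFDerivAt_snd).fderiv x

theorem pd_inl_comp_fst (hu : DifferentiableAt ℝ u z.1) (i : ι) :
    pd (b.prod b') (inl i) (fun w => u w.1) z = pd b i u z.1 := by
  simp [pd, fderiv_comp_fst_apply hu]

theorem pd_inr_comp_fst (hu : DifferentiableAt ℝ u z.1) (i : ι') :
    pd (b.prod b') (inr i) (fun w => u w.1) z = 0 := by
  simp [pd, fderiv_comp_fst_apply hu]

theorem pd_inl_comp_snd (hv : DifferentiableAt ℝ v z.2) (i : ι) :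
    pd (b.prod b') (inl i) (fun w => v w.2) z = 0 := by
  simp [pd, fderiv_comp_snd_apply hv]

theorem pd_inr_comp_snd (hv : DifferentiableAt ℝ v z.2) (i : ι') :
    pd (b.prod b') (inr i) (fun w => v w.2) z = pd b' i v z.2 := by
  simp [pd, fderiv_comp_snd_apply hv]

theorem pd_inl_mul (hu : DifferentiableAt ℝ u z.1) (hv : DifferentiableAt ℝ v z.2) (i : ι) :
    pd (b.prod b') (inl i) (fun w => u w.1 * v w.2) z = pd b i u z.1 * v z.2 := by
  have hu' : DifferentiableAt ℝ (fun w : E × E' => u w.1) z := hu.comp z differentiableAt_fst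
  have hv' : DifferentiableAt ℝ (fun w : E × E' => v w.2) z := hv.comp z differentiableAt_snd
  rw [pd_mul _ hu' hv', pd_inl_comp_fst b b' hu, pd_inl_comp_snd b b' hv, mul_zero, add_zero]

theorem pd_inr_mul (hu : DifferentiableAt ℝ u z.1) (hv : DifferentiableAt ℝ v z.2) (i : ι') :
    pd (b.prod b') (inr i) (fun w => u w.1 * v w.2) z = u z.1 * pd b' i v z.2 := by
  have hu' : DifferentiableAt ℝ (fun w : E × E' => u w.1) z := hu.comp z differentiableAt_fst
  have hv' : DifferentiableAt ℝ (fun w : E × E' => v w.2) z := hv.comp z differentiableAt_snd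
  rw [pd_mul _ hu' hv', pd_inr_comp_fst b b' hu, pd_inr_comp_snd b b' hv, zero_mul, zero_add]

/-- The components of the warped product metric in product coordinates. -/
def blockMetric (g : E → Matrix ι ι ℝ) (g' : E' → Matrix ι' ι' ℝ) (f : E → ℝ) (w : E × E') :
    Matrix (ι ⊕ ι') (ι ⊕ ι') ℝ :=
  Matrix.fromBlocks (g w.1) 0 0 (f w.1 • g' w.2)

theorem pd_blockMetric_inl_inr {g : E → Matrix ι ι ℝ} {g' : E' → Matrix ι' ι' ℝ} {f : E → ℝ}
    (i : ι ⊕ ι') (c : ι) (β : ι') :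
    pd (b.prod b') i (fun w => blockMetric g g' f w (inl c) (inr β)) z = 0 :=
  pd_const _ _ _

theorem pd_blockMetric_inr_inl {g : E → Matrix ι ι ℝ} {g' : E' → Matrix ι' ι' ℝ} {f : E → ℝ}
    (i : ι ⊕ ι') (c : ι) (β : ι') :
    pd (b.prod b') i (fun w => blockMetric g g' f w (inr β) (inl c)) z = 0 :=
  pd_const _ _ _

end ProductBasis

section WarpedCoordinates

open Sum

variable {ι E : Type*} [Fintype ι] [DecidableEq ι] [NormedAddCommGroup E] [NormedSpace ℝ E]
  {ι' E' : Type*} [Fintype ι'] [DecidableEq ι'] [NormedAddCommGroup E'] [NormedSpace ℝ E']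

/-- The gradient `f^a = g^{ac} f_c`. -/
def gradient (b : Basis ι ℝ E) (g : E → Matrix ι ι ℝ) (f : E → ℝ) (a : ι) (z : E) : ℝ :=
  ∑ c, (g z)⁻¹ a c * pd b c f z

theorem mul_scalarP (b : Basis ι ℝ E) (g : E → Matrix ι ι ℝ) {f : E → ℝ} {z : E} (hf : f z ≠ 0) :
    f z * scalarP b g f z = 1 / 4 * (f z)⁻¹ * ∑ c, gradient b g f c z * pd b c f z := by
  simp only [scalarP, gradient, Finset.sum_mul, mul_right_comm, ← mul_assoc]
  field_simp

/-- The data of a warped product in product coordinates ranging over `s ×ˢ t`. -/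
structure IsWarpedOn (g : E → Matrix ι ι ℝ) (s : Set E) (g' : E' → Matrix ι' ι' ℝ) (t : Set E')
    (f : E → ℝ) : Prop where
  base : IsMetricOn g s
  fiber : IsMetricOn g' t
  smooth : ContDiffOn ℝ ∞ f s
  ne_zero : ∀ z ∈ s, f z ≠ 0

namespace IsWarpedOn

variable (b : Basis ι ℝ E) (b' : Basis ι' ℝ E') {g : E → Matrix ι ι ℝ} {s : Set E}
  {g' : E' → Matrix ι' ι' ℝ} {t : Set E'} {f : E → ℝ} {z : E × E'}

theorem inv_blockMetric (H : IsWarpedOn g s g' t f) (hz : z ∈ s ×ˢ t) :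
    (blockMetric g g' f z)⁻¹ =
      Matrix.fromBlocks (g z.1)⁻¹ 0 0 ((f z.1)⁻¹ • (g' z.2)⁻¹) := by
  have base_inv := Matrix.mul_nonsing_inv _ (H.base.isUnit z.1 hz.1)
  have fiber_inv := Matrix.mul_nonsing_inv _ (H.fiber.isUnit z.2 hz.2)
  apply Matrix.inv_eq_right_inv
  simp [blockMetric, Matrix.fromBlocks_multiply, base_inv, fiber_inv, H.ne_zero z.1 hz.1,
    smul_smul, ← Matrix.fromBlocks_one]

theorem isMetricOn (H : IsWarpedOn g s g' t f) :
    IsMetricOn (blockMetric g g' f) (s ×ˢ t) where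
  isOpen := H.base.isOpen.prod H.fiber.isOpen
  smooth := by
    rintro (i | i) (j | j)
    · exact (H.base.smooth i j).comp contDiffOn_fst fun w hw => hw.1
    · exact contDiffOn_const
    · exact contDiffOn_const
    · exact (H.smooth.comp contDiffOn_fst fun w hw => hw.1).mul
        ((H.fiber.smooth i j).comp contDiffOn_snd fun w hw => hw.2)
  symm z hz := (H.base.symm z.1 hz.1).fromBlocks Matrix.transpose_zero
    ((H.fiber.symm z.2 hz.2).smul _)
  isUnit z hz := by
    have base_det := (H.base.isUnit z.1 hz.1).ne_zero
    have fiber_det := (H.fiber.isUnit z.2 hz.2).ne_zero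
    simp [blockMetric, Matrix.det_fromBlocks_zero₂₁, base_det, fiber_det, H.ne_zero z.1 hz.1]

section Derivatives

variable {a c d : ι} {α β γ : ι'}

theorem differentiableAt (H : IsWarpedOn g s g' t f) (hz : z ∈ s ×ˢ t) :
    DifferentiableAt ℝ f z.1 :=
  differentiableAt_of_contDiffOn H.base.isOpen H.smooth hz.1

theorem differentiableAt_pd (H : IsWarpedOn g s g' t f) (hz : z ∈ s ×ˢ t) :
    DifferentiableAt ℝ (pd b a f) z.1 :=
  differentiableAt_of_contDiffOn H.base.isOpen (contDiffOn_pd b H.base.isOpen H.smooth a) hz.1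

theorem differentiableAt_inv (H : IsWarpedOn g s g' t f) (hz : z ∈ s ×ˢ t) :
    DifferentiableAt ℝ (fun w => (f w)⁻¹) z.1 :=
  (H.differentiableAt hz).fun_inv (H.ne_zero z.1 hz.1)

theorem pd_inl_base (H : IsWarpedOn g s g' t f) (hz : z ∈ s ×ˢ t) :
    pd (b.prod b') (inl a) (fun w => blockMetric g g' f w (inl c) (inl d)) z
      = pd b a (fun w => g w c d) z.1 :=
  pd_inl_comp_fst b b' (H.base.differentiableAt hz.1 c d) a

theorem pd_inr_base (H : IsWarpedOn g s g' t f) (hz : z ∈ s ×ˢ t) :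
    pd (b.prod b') (inr α) (fun w => blockMetric g g' f w (inl c) (inl d)) z = 0 :=
  pd_inr_comp_fst b b' (H.base.differentiableAt hz.1 c d) α

theorem pd_inl_fiber (H : IsWarpedOn g s g' t f) (hz : z ∈ s ×ˢ t) :
    pd (b.prod b') (inl a) (fun w => blockMetric g g' f w (inr β) (inr γ)) z
      = pd b a f z.1 * g' z.2 β γ :=
  pd_inl_mul b b' (H.differentiableAt hz) (H.fiber.differentiableAt hz.2 β γ) a

theorem pd_inr_fiber (H : IsWarpedOn g s g' t f) (hz : z ∈ s ×ˢ t) :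
    pd (b.prod b') (inr α) (fun w => blockMetric g g' f w (inr β) (inr γ)) z
      = f z.1 * pd b' α (fun w => g' w β γ) z.2 :=
  pd_inr_mul b b' (H.differentiableAt hz) (H.fiber.differentiableAt hz.2 β γ) α

end Derivatives

section Christoffel

theorem christoffel_base (H : IsWarpedOn g s g' t f) (hz : z ∈ s ×ˢ t) (a c d : ι) :
    christoffel (b.prod b') (blockMetric g g' f) (inl a) (inl c) (inl d) z
      = christoffel b g a c d z.1 := by
  simp [christoffel, H.inv_blockMetric hz, H.pd_inl_base b b' hz]

theorem christoffel_base_mixed (H : IsWarpedOn g s g' t f) (hz : z ∈ s ×ˢ t) (a c : ι) (β : ι') :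
    christoffel (b.prod b') (blockMetric g g' f) (inl a) (inl c) (inr β) z = 0 := by
  simp [christoffel, H.inv_blockMetric hz, H.pd_inr_base b b' hz, pd_blockMetric_inl_inr]

theorem christoffel_base_mixed' (H : IsWarpedOn g s g' t f) (hz : z ∈ s ×ˢ t) (a c : ι) (β : ι') :
    christoffel (b.prod b') (blockMetric g g' f) (inl a) (inr β) (inl c) z = 0 := by
  rw [H.isMetricOn.christoffel_symm _ hz, H.christoffel_base_mixed b b' hz]

theorem christoffel_base_fiber (H : IsWarpedOn g s g' t f) (hz : z ∈ s ×ˢ t) (a : ι) (β γ : ι') :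
    christoffel (b.prod b') (blockMetric g g' f) (inl a) (inr β) (inr γ) z
      = -(1 / 2) * gradient b g f a z.1 * g' z.2 β γ := by
  simp only [christoffel, H.inv_blockMetric hz, H.pd_inl_fiber b b' hz, pd_blockMetric_inl_inr,
    Fintype.sum_sum_type, Matrix.fromBlocks_apply₁₁, Matrix.fromBlocks_apply₁₂, gradient,
    Matrix.zero_apply, zero_mul, Finset.sum_const_zero, add_zero, Finset.mul_sum, Finset.sum_mul]
  exact Finset.sum_congr rfl fun _ _ => by ring

theorem christoffel_fiber_base (H : IsWarpedOn g s g' t f) (hz : z ∈ s ×ˢ t) (α : ι') (c d : ι) :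
    christoffel (b.prod b') (blockMetric g g' f) (inr α) (inl c) (inl d) z = 0 := by
  simp [christoffel, H.inv_blockMetric hz, H.pd_inr_base b b' hz, pd_blockMetric_inr_inl]

theorem christoffel_fiber_mixed (H : IsWarpedOn g s g' t f) (hz : z ∈ s ×ˢ t) (α : ι') (c : ι)
    (β : ι') :
    christoffel (b.prod b') (blockMetric g g' f) (inr α) (inl c) (inr β) z
      = 1 / 2 * (pd b c f z.1 * (f z.1)⁻¹) * (if α = β then 1 else 0) := by
  simp only [christoffel, H.inv_blockMetric hz, H.pd_inl_fiber b b' hz, pd_blockMetric_inl_inr,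
    pd_blockMetric_inr_inl, Fintype.sum_sum_type, Matrix.fromBlocks_apply₂₁,
    Matrix.fromBlocks_apply₂₂, Matrix.zero_apply, zero_mul, Finset.sum_const_zero, zero_add,
    add_zero, sub_zero, Matrix.smul_apply, smul_eq_mul]
  rw [← H.fiber.inv_mul hz.2 α β, Finset.mul_sum, Finset.mul_sum]
  exact Finset.sum_congr rfl fun _ _ => by ring

theorem christoffel_fiber_mixed' (H : IsWarpedOn g s g' t f) (hz : z ∈ s ×ˢ t) (α : ι') (c : ι)
    (β : ι') :
    christoffel (b.prod b') (blockMetric g g' f) (inr α) (inr β) (inl c) z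
      = 1 / 2 * (pd b c f z.1 * (f z.1)⁻¹) * (if α = β then 1 else 0) := by
  rw [H.isMetricOn.christoffel_symm _ hz, H.christoffel_fiber_mixed b b' hz]

theorem christoffel_fiber (H : IsWarpedOn g s g' t f) (hz : z ∈ s ×ˢ t) (α β γ : ι') :
    christoffel (b.prod b') (blockMetric g g' f) (inr α) (inr β) (inr γ) z
      = christoffel b' g' α β γ z.2 := by
  have hf := H.ne_zero z.1 hz.1
  simp only [christoffel, H.inv_blockMetric hz, H.pd_inr_fiber b b' hz, pd_blockMetric_inl_inr,
    Fintype.sum_sum_type, Matrix.fromBlocks_apply₂₁, Matrix.fromBlocks_apply₂₂,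
    Matrix.zero_apply, zero_mul, Finset.sum_const_zero, zero_add,
    Matrix.smul_apply, smul_eq_mul]
  congr 1
  exact Finset.sum_congr rfl fun _ _ => by field_simp

theorem pd_christoffel_eq_zero (H : IsWarpedOn g s g' t f) (hz : z ∈ s ×ˢ t) {i j k : ι ⊕ ι'}
    (h : ∀ w ∈ s ×ˢ t, christoffel (b.prod b') (blockMetric g g' f) i j k w = 0) (n : ι ⊕ ι') :
    pd (b.prod b') n (christoffel (b.prod b') (blockMetric g g' f) i j k) z = 0 := by
  rw [pd_congr _ H.isMetricOn.isOpen h hz, pd_const]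

theorem pd_inl_christoffel_base (H : IsWarpedOn g s g' t f) (hz : z ∈ s ×ˢ t) (a c d e : ι) :
    pd (b.prod b') (inl e)
      (christoffel (b.prod b') (blockMetric g g' f) (inl a) (inl c) (inl d)) z
      = pd b e (christoffel b g a c d) z.1 := by
  rw [pd_congr _ H.isMetricOn.isOpen (fun w hw => H.christoffel_base b b' hw a c d) hz,
    pd_inl_comp_fst b b' (H.base.differentiableAt_christoffel b a c d hz.1)]

theorem pd_inr_christoffel_base (H : IsWarpedOn g s g' t f) (hz : z ∈ s ×ˢ t) (a c d : ι)
    (β : ι') :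
    pd (b.prod b') (inr β)
      (christoffel (b.prod b') (blockMetric g g' f) (inl a) (inl c) (inl d)) z = 0 := by
  rw [pd_congr _ H.isMetricOn.isOpen (fun w hw => H.christoffel_base b b' hw a c d) hz,
    pd_inr_comp_fst b b' (H.base.differentiableAt_christoffel b a c d hz.1)]

theorem pd_inl_christoffel_fiber (H : IsWarpedOn g s g' t f) (hz : z ∈ s ×ˢ t) (α β γ : ι')
    (a : ι) :
    pd (b.prod b') (inl a)
      (christoffel (b.prod b') (blockMetric g g' f) (inr α) (inr β) (inr γ)) z = 0 := by
  rw [pd_congr _ H.isMetricOn.isOpen (fun w hw => H.christoffel_fiber b b' hw α β γ) hz,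
    pd_inl_comp_snd b b' (H.fiber.differentiableAt_christoffel b' α β γ hz.2)]

theorem pd_inr_christoffel_fiber (H : IsWarpedOn g s g' t f) (hz : z ∈ s ×ˢ t)
    (α β γ δ : ι') :
    pd (b.prod b') (inr δ)
      (christoffel (b.prod b') (blockMetric g g' f) (inr α) (inr β) (inr γ)) z
      = pd b' δ (christoffel b' g' α β γ) z.2 := by
  rw [pd_congr _ H.isMetricOn.isOpen (fun w hw => H.christoffel_fiber b b' hw α β γ) hz,
    pd_inr_comp_snd b b' (H.fiber.differentiableAt_christoffel b' α β γ hz.2)]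

theorem pd_inl_christoffel_fiber_mixed (H : IsWarpedOn g s g' t f) (hz : z ∈ s ×ˢ t)
    (α β : ι') (a c : ι) :
    pd (b.prod b') (inl c)
      (christoffel (b.prod b') (blockMetric g g' f) (inr α) (inl a) (inr β)) z
      = 1 / 2 * (pd b c (pd b a f) z.1 * (f z.1)⁻¹ - pd b a f z.1 * (pd b c f z.1 / f z.1 ^ 2))
        * (if α = β then 1 else 0) := by
  have hd := (H.differentiableAt_pd b hz (a := a)).fun_mul (H.differentiableAt_inv hz)
  rw [pd_congr _ H.isMetricOn.isOpen (fun w hw => H.christoffel_fiber_mixed b b' hw α a β) hz,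
    pd_inl_mul b b' (v := fun _ => if α = β then 1 else 0) (hd.const_mul _)
      (differentiableAt_const _),
    pd_const_mul b _ hd, pd_mul b (H.differentiableAt_pd b hz) (H.differentiableAt_inv hz),
    pd_inv b (H.differentiableAt hz) (H.ne_zero z.1 hz.1)]
  ring

theorem pd_inr_christoffel_fiber_mixed (H : IsWarpedOn g s g' t f) (hz : z ∈ s ×ˢ t)
    (α β γ : ι') (a : ι) :
    pd (b.prod b') (inr γ)
      (christoffel (b.prod b') (blockMetric g g' f) (inr α) (inl a) (inr β)) z = 0 := by
  have hd := (H.differentiableAt_pd b hz (a := a)).fun_mul (H.differentiableAt_inv hz)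
  rw [pd_congr _ H.isMetricOn.isOpen (fun w hw => H.christoffel_fiber_mixed b b' hw α a β) hz,
    pd_inr_mul b b' (v := fun _ => if α = β then 1 else 0) (hd.const_mul _)
      (differentiableAt_const _), pd_const, mul_zero]

theorem pd_inr_christoffel_fiber_mixed' (H : IsWarpedOn g s g' t f) (hz : z ∈ s ×ˢ t)
    (α β γ : ι') (a : ι) :
    pd (b.prod b') (inr γ)
      (christoffel (b.prod b') (blockMetric g g' f) (inr α) (inr β) (inl a)) z = 0 := by
  rw [pd_congr _ H.isMetricOn.isOpen (fun w hw => H.isMetricOn.christoffel_symm _ hw _ _ _) hz,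
    H.pd_inr_christoffel_fiber_mixed b b' hz]

end Christoffel

section Curvature

theorem curvOp_base (H : IsWarpedOn g s g' t f) (hz : z ∈ s ×ˢ t) (l a c d : ι) :
    curvOp (b.prod b') (blockMetric g g' f) z (inl l) (inl a) (inl c) (inl d)
      = curvOp b g z.1 l a c d := by
  simp [curvOp, H.pd_inl_christoffel_base b b' hz, H.christoffel_base b b' hz,
    H.christoffel_fiber_base b b' hz]

theorem curvOp_fiber_base_base_fiber (H : IsWarpedOn g s g' t f) (hz : z ∈ s ×ˢ t) (α δ : ι')
    (a c : ι) :
    curvOp (b.prod b') (blockMetric g g' f) z (inr α) (inl a) (inl c) (inr δ)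
      = tensorT b g f z.1 a c * (if α = δ then 1 else 0) := by
  have hf := H.ne_zero z.1 hz.1
  have sum_base : ∑ x, christoffel b g x a c z.1 *
        (1 / 2 * (pd b x f z.1 * (f z.1)⁻¹) * if α = δ then 1 else 0)
      = 1 / 2 * (f z.1)⁻¹ * (if α = δ then 1 else 0)
        * ∑ d, christoffel b g d a c z.1 * pd b d f z.1 := by
    rw [Finset.mul_sum]
    exact Finset.sum_congr rfl fun _ _ => by ring
  have sum_fiber : ∑ γ, 1 / 2 * (pd b a f z.1 * (f z.1)⁻¹) * (if γ = δ then 1 else 0) *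
        (1 / 2 * (pd b c f z.1 * (f z.1)⁻¹) * (if α = γ then 1 else 0))
      = 1 / 4 * (pd b a f z.1 * pd b c f z.1 * (f z.1)⁻¹ ^ 2) * (if α = δ then 1 else 0) := by
    simp only [mul_ite, mul_one, mul_zero, ite_mul, zero_mul, Finset.sum_ite_eq, Finset.mem_univ,
      if_true]
    split_ifs
    · ring
    · rfl
  simp only [curvOp, H.pd_inl_christoffel_fiber_mixed b b' hz, Fintype.sum_sum_type,
    H.pd_christoffel_eq_zero b b' hz fun _ hw => H.christoffel_fiber_base b b' hw α a c,
    H.christoffel_base b b' hz, H.christoffel_base_mixed b b' hz, H.christoffel_fiber_base b b' hz,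
    H.christoffel_fiber_mixed b b' hz, H.christoffel_fiber_mixed' b b' hz, zero_mul, mul_zero,
    sub_zero, zero_sub, Finset.sum_neg_distrib, sum_base, sum_fiber, tensorT, hess,
    Matrix.of_apply]
  field_simp
  ring

theorem curvOp_fiber (H : IsWarpedOn g s g' t f) (hz : z ∈ s ×ˢ t) (α β γ δ : ι') :
    curvOp (b.prod b') (blockMetric g g' f) z (inr α) (inr β) (inr γ) (inr δ)
      = curvOp b' g' z.2 α β γ δ - f z.1 * scalarP b g f z.1 *
          (g' z.2 β γ * (if α = δ then 1 else 0) - g' z.2 β δ * (if α = γ then 1 else 0)) := by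
  have sum_base (γ δ : ι') : ∑ c, (-(1 / 2) * gradient b g f c z.1 * g' z.2 β γ *
        (1 / 2 * (pd b c f z.1 * (f z.1)⁻¹) * if α = δ then 1 else 0))
      = - (f z.1 * scalarP b g f z.1 * (g' z.2 β γ * (if α = δ then 1 else 0))) := by
    rw [mul_scalarP b g (H.ne_zero z.1 hz.1), Finset.mul_sum, Finset.sum_mul,
      ← Finset.sum_neg_distrib]
    exact Finset.sum_congr rfl fun _ _ => by ring
  simp only [curvOp, H.pd_inr_christoffel_fiber b b' hz, Fintype.sum_sum_type,
    H.christoffel_base_fiber b b' hz, H.christoffel_fiber_mixed b b' hz,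
    H.christoffel_fiber b b' hz, Finset.sum_sub_distrib, sum_base]
  ring

theorem riem_base (H : IsWarpedOn g s g' t f) (hz : z ∈ s ×ˢ t) (h a c d : ι) :
    riem (b.prod b') (blockMetric g g' f) z (inl h) (inl a) (inl c) (inl d)
      = riem b g z.1 h a c d := by
  simp [riem_eq_sum_curvOp, H.curvOp_base b b' hz, blockMetric]

theorem riem_base_fiber_fiber_base (H : IsWarpedOn g s g' t f) (hz : z ∈ s ×ˢ t) (a d : ι)
    (β γ : ι') :
    riem (b.prod b') (blockMetric g g' f) z (inl a) (inr β) (inr γ) (inl d)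
      = f z.1 * tensorT b g f z.1 a d * g' z.2 β γ := by
  rw [H.isMetricOn.riem_antisymm _ hz, riem_swap, neg_neg, riem_eq_sum_curvOp]
  simp [blockMetric, H.curvOp_fiber_base_base_fiber b b' hz, mul_right_comm _ (g' z.2 β γ)]

theorem riem_fiber (H : IsWarpedOn g s g' t f) (hz : z ∈ s ×ˢ t) (α β γ δ : ι') :
    riem (b.prod b') (blockMetric g g' f) z (inr α) (inr β) (inr γ) (inr δ)
      = f z.1 * riem b' g' z.2 α β γ δ
        - f z.1 ^ 2 * scalarP b g f z.1 * (1 / 2 * kn (g' z.2) (g' z.2) α β γ δ) := by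
  have lower (β γ δ : ι') : ∑ l, g' z.2 α l * (g' z.2 β γ * if l = δ then 1 else 0)
      = g' z.2 α δ * g' z.2 β γ := by simp
  simp only [riem_eq_sum_curvOp, Fintype.sum_sum_type, H.curvOp_fiber b b' hz,
    blockMetric, Matrix.fromBlocks_apply₂₁, Matrix.fromBlocks_apply₂₂, Matrix.zero_apply, zero_mul,
    Finset.sum_const_zero, zero_add, Matrix.smul_apply, smul_eq_mul, half_kn_self]
  rw [← lower β γ δ, ← lower β δ γ, ← Finset.sum_sub_distrib, Finset.mul_sum, Finset.mul_sum,
    ← Finset.sum_sub_distrib]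
  exact Finset.sum_congr rfl fun _ _ => by ring

theorem curvOp_base_fiber_fiber_base (H : IsWarpedOn g s g' t f) (hz : z ∈ s ×ˢ t) (l d : ι)
    (β γ : ι') :
    curvOp (b.prod b') (blockMetric g g' f) z (inl l) (inr β) (inr γ) (inl d)
      = f z.1 * g' z.2 β γ * ∑ a, (g z.1)⁻¹ l a * tensorT b g f z.1 a d := by
  rw [← H.isMetricOn.raise_riem _ hz, Fintype.sum_sum_type, Finset.mul_sum]
  simp only [H.inv_blockMetric hz, Matrix.fromBlocks_apply₁₁, Matrix.fromBlocks_apply₁₂,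
    Matrix.zero_apply, zero_mul, Finset.sum_const_zero, add_zero,
    H.riem_base_fiber_fiber_base b b' hz]
  exact Finset.sum_congr rfl fun _ _ => by ring

theorem ricci_base (H : IsWarpedOn g s g' t f) (hz : z ∈ s ×ˢ t) (a c : ι) :
    ricci (b.prod b') (blockMetric g g' f) z (inl a) (inl c)
      = ricci b g z.1 a c + Fintype.card ι' * tensorT b g f z.1 a c := by
  rw [H.isMetricOn.ricci_eq _ hz, Fintype.sum_sum_type, H.base.ricci_eq b hz.1]
  simp [H.curvOp_base b b' hz, H.curvOp_fiber_base_base_fiber b b' hz]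

theorem ricci_mixed (H : IsWarpedOn g s g' t f) (hz : z ∈ s ×ˢ t) (a : ι) (β : ι') :
    ricci (b.prod b') (blockMetric g g' f) z (inl a) (inr β) = 0 := by
  rw [H.isMetricOn.ricci_eq _ hz, Fintype.sum_sum_type]
  simp only [curvOp, H.pd_inr_christoffel_base b b' hz,
    H.pd_christoffel_eq_zero b b' hz fun _ hw => H.christoffel_base_mixed b b' hw _ _ _,
    H.pd_inr_christoffel_fiber_mixed b b' hz, Fintype.sum_sum_type,
    H.christoffel_base_mixed b b' hz, H.christoffel_base_mixed' b b' hz,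
    H.christoffel_fiber_base b b' hz, H.christoffel_fiber_mixed b b' hz,
    H.christoffel_fiber b b' hz]
  simp [H.fiber.christoffel_symm b' hz.2 _ β]

theorem ricci_mixed' (H : IsWarpedOn g s g' t f) (hz : z ∈ s ×ˢ t) (a : ι) (β : ι') :
    ricci (b.prod b') (blockMetric g g' f) z (inr β) (inl a) = 0 := by
  rw [H.isMetricOn.ricci_eq _ hz, Fintype.sum_sum_type]
  simp only [curvOp, H.pd_inl_christoffel_fiber b b' hz,
    H.pd_christoffel_eq_zero b b' hz fun _ hw => H.christoffel_base_mixed' b b' hw _ _ _,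
    H.pd_inr_christoffel_fiber_mixed' b b' hz, Fintype.sum_sum_type,
    H.christoffel_base_mixed' b b' hz, H.christoffel_fiber_base b b' hz,
    H.christoffel_fiber_mixed' b b' hz, H.christoffel_fiber b b' hz]
  simp [mul_comm]

theorem ricci_fiber (H : IsWarpedOn g s g' t f) (hz : z ∈ s ×ˢ t) (β γ : ι') :
    ricci (b.prod b') (blockMetric g g' f) z (inr β) (inr γ)
      = ricci b' g' z.2 β γ + f z.1 * (tr (g z.1) (tensorT b g f z.1)
          - ((Fintype.card ι' : ℝ) - 1) * scalarP b g f z.1) * g' z.2 β γ := by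
  have tr_eq : tr (g z.1) (tensorT b g f z.1)
      = ∑ l, ∑ a, (g z.1)⁻¹ l a * tensorT b g f z.1 a l := by
    rw [tr, Finset.sum_comm]
    simp only [(H.base.inv_symm hz.1).apply]
  have sum_fiber : ∑ α, (g' z.2 β γ - g' z.2 β α * (if α = γ then 1 else 0))
      = ((Fintype.card ι' : ℝ) - 1) * g' z.2 β γ := by
    simp [sub_mul]
  rw [H.isMetricOn.ricci_eq _ hz, Fintype.sum_sum_type, H.fiber.ricci_eq b' hz.2]
  simp only [H.curvOp_base_fiber_fiber_base b b' hz, H.curvOp_fiber b b' hz, ← Finset.mul_sum,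
    Finset.sum_sub_distrib (f := fun α => curvOp b' g' z.2 α β γ α), if_true, mul_one, ← tr_eq,
    sum_fiber]
  ring

end Curvature

end IsWarpedOn
end WarpedCoordinates

section Locality

variable {ι E : Type*} [Fintype ι] [DecidableEq ι] [NormedAddCommGroup E] [NormedSpace ℝ E]
  {g g' : E → Matrix ι ι ℝ} {z : E}

theorem christoffel_congr (b : Basis ι ℝ E) (h : g =ᶠ[nhds z] g') (l i j : ι) :
    christoffel b g l i j z = christoffel b g' l i j z := by
  have hpd : ∀ k i j, pd b k (fun w => g w i j) z = pd b k (fun w => g' w i j) z := fun k i j =>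
    pd_congr_of_eventuallyEq b (h.mono fun w hw => by simp only [hw]) k
  simp only [christoffel, hpd, h.eq_of_nhds]

theorem riem_congr (b : Basis ι ℝ E) (h : g =ᶠ[nhds z] g') : riem b g z = riem b g' z := by
  have hΓ : ∀ l i j, christoffel b g l i j =ᶠ[nhds z] christoffel b g' l i j := fun l i j =>
    h.eventually_nhds.mono fun w hw => christoffel_congr b hw l i j
  ext i j k l
  simp only [riem, h.eq_of_nhds, pd_congr_of_eventuallyEq b (hΓ _ _ _), (hΓ _ _ _).eq_of_nhds]

theorem ricci_congr (b : Basis ι ℝ E) (h : g =ᶠ[nhds z] g') : ricci b g z = ricci b g' z := by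
  simp only [ricci, riem_congr b h, h.eq_of_nhds]

end Locality

/-! ### Metrics in the charts of a manifold -/

section Charts

variable {ι E M : Type*} [Fintype ι] [DecidableEq ι] [NormedAddCommGroup E] [NormedSpace ℝ E]
  [TopologicalSpace M] {e : OpenPartialHomeomorph M E}

theorem extend_mem_target {q : M} (hq : q ∈ e.source) :
    e.extend 𝓘(ℝ, E) q ∈ (e.extend 𝓘(ℝ, E)).target :=
  (e.extend 𝓘(ℝ, E)).map_source (by rwa [e.extend_source])

theorem extend_symm_mem_source {z : E} (hz : z ∈ (e.extend 𝓘(ℝ, E)).target) :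
    (e.extend 𝓘(ℝ, E)).symm z ∈ e.source := by
  simpa [mfld_simps] using (e.extend 𝓘(ℝ, E)).map_target hz

theorem det_ne_zero_of_nondegenerate (b : Basis ι ℝ E) {V : Type*} [AddCommGroup V] [Module ℝ V]
    (φ : E →ₗ[ℝ] V) (hφ : Function.Bijective φ) (B : LinearMap.BilinForm ℝ V)
    (hB : ∀ u, (∀ v, B u v = 0) → u = 0) :
    (Matrix.of fun i j => B (φ (b i)) (φ (b j))).det ≠ 0 := by
  have hcomp : LinearMap.SeparatingLeft (B.comp φ φ) := by
    intro u hu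
    refine hφ.1 ((hB _ fun v => ?_).trans (map_zero φ).symm)
    obtain ⟨w, rfl⟩ := hφ.2 v
    exact hu w
  rw [← LinearMap.BilinForm.separatingLeft_toMatrix_iff b,
    Matrix.separatingLeft_iff_det_ne_zero] at hcomp
  convert hcomp using 2
  ext i j
  rw [LinearMap.BilinForm.toMatrix_apply, Matrix.of_apply, LinearMap.BilinForm.comp_apply]

variable [ChartedSpace E M] [IsManifold 𝓘(ℝ, E) ∞ M]

theorem contMDiffOn_extend_target (he : e ∈ atlas E M) :
    ContMDiffOn 𝓘(ℝ, E) 𝓘(ℝ, E) ∞ (e.extend 𝓘(ℝ, E)).symm (e.extend 𝓘(ℝ, E)).target := by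
  simpa [mfld_simps] using contMDiffOn_extend_symm (I := 𝓘(ℝ, E)) (n := ∞)
    (IsManifold.subset_maximalAtlas he)

theorem mdifferentiableAt_extend_symm (he : e ∈ atlas E M) {z : E}
    (hz : z ∈ (e.extend 𝓘(ℝ, E)).target) :
    MDifferentiableAt 𝓘(ℝ, E) 𝓘(ℝ, E) (e.extend 𝓘(ℝ, E)).symm z :=
  ((contMDiffOn_extend_target he).contMDiffAt
    (e.isOpen_extend_target.mem_nhds hz)).mdifferentiableAt (by simp)

theorem IsScalar.contDiffOn_comp_extend_symm {u : M → ℝ} (hu : IsScalar 𝓘(ℝ, E) u)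
    (he : e ∈ atlas E M) :
    ContDiffOn ℝ ∞ (u ∘ (e.extend 𝓘(ℝ, E)).symm) (e.extend 𝓘(ℝ, E)).target :=
  (ContMDiff.comp_contMDiffOn hu (contMDiffOn_extend_target he)).contDiffOn

theorem bijective_mfderiv_extend_symm (he : e ∈ atlas E M) {z : E}
    (hz : z ∈ (e.extend 𝓘(ℝ, E)).target) :
    Function.Bijective (mfderiv 𝓘(ℝ, E) 𝓘(ℝ, E) (e.extend 𝓘(ℝ, E)).symm z) :=
  (mdifferentiable_of_mem_atlas (I := 𝓘(ℝ, E)) he).symm.mfderiv_bijective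
    (by simpa [mfld_simps] using hz)

theorem IsSemiRiemannian.isMetricOn {b : Basis ι ℝ E} {g : FormField 𝓘(ℝ, E) M}
    (hg : IsSemiRiemannian 𝓘(ℝ, E) b g) (he : e ∈ atlas E M) :
    IsMetricOn (metricCoord 𝓘(ℝ, E) b g e) (e.extend 𝓘(ℝ, E)).target where
  isOpen := e.isOpen_extend_target
  smooth := hg.smooth e he
  symm _ _ := Matrix.IsSymm.ext fun _ _ => hg.symm _ _ _
  isUnit z hz := isUnit_iff_ne_zero.2 <| det_ne_zero_of_nondegenerate b
    (mfderiv 𝓘(ℝ, E) 𝓘(ℝ, E) (e.extend 𝓘(ℝ, E)).symm z).toLinearMap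
    (bijective_mfderiv_extend_symm he hz) _ (hg.nondegenerate _)

theorem isLocallyConstant_of_fderiv_comp_extend_symm_eq_zero {u : M → ℝ}
    (hu : IsScalar 𝓘(ℝ, E) u)
    (h : ∀ e ∈ atlas E M, ∀ z ∈ (e.extend 𝓘(ℝ, E)).target,
      fderiv ℝ (u ∘ (e.extend 𝓘(ℝ, E)).symm) z = 0) : IsLocallyConstant u := by
  rw [IsLocallyConstant.iff_eventually_eq]
  intro y
  set φ := extChartAt 𝓘(ℝ, E) y
  have hy : y ∈ φ.source := mem_extChartAt_source y
  obtain ⟨r, hr, hball⟩ :=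
    Metric.isOpen_iff.1 (isOpen_extChartAt_target y) _ (φ.map_source hy)
  have hconst : ∀ z ∈ Metric.ball (φ y) r, u (φ.symm z) = u (φ.symm (φ y)) := fun z hz =>
    Metric.isOpen_ball.is_const_of_fderiv_eq_zero (𝕜 := ℝ) (convex_ball _ r).isPreconnected
      (((hu.contDiffOn_comp_extend_symm (chart_mem_atlas E y)).differentiableOn (by simp)).mono
        hball)
      (fun w hw => h _ (chart_mem_atlas E y) w (hball hw)) hz (Metric.mem_ball_self hr)
  filter_upwards [extChartAt_source_mem_nhds (I := 𝓘(ℝ, E)) y,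
    (continuousAt_extChartAt (I := 𝓘(ℝ, E)) y).preimage_mem_nhds (Metric.ball_mem_nhds _ hr)]
    with y' hsource hy'
  have hsymm := hconst _ hy'
  rwa [φ.left_inv hsource, φ.left_inv hy] at hsymm

theorem HasPointwiseConstantCurvature.hasConstantCurvature [ConnectedSpace M] {b : Basis ι ℝ E}
    {g : FormField 𝓘(ℝ, E) M} (h : HasPointwiseConstantCurvature 𝓘(ℝ, E) b g)
    (hg : IsSemiRiemannian 𝓘(ℝ, E) b g) (hι : 3 ≤ Fintype.card ι) :
    HasConstantCurvature 𝓘(ℝ, E) b g := by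
  obtain ⟨μ, hμ, hR⟩ := h
  have hloc : IsLocallyConstant μ := by
    refine isLocallyConstant_of_fderiv_comp_extend_symm_eq_zero hμ fun e he z hz => ?_
    refine ContinuousLinearMap.coe_injective (b.ext fun i => ?_)
    refine (hg.isMetricOn he).schur (hμ.contDiffOn_comp_extend_symm he) (fun w hw j k l n => ?_)
      hz hι i
    simpa only [rAt, gAt, Function.comp_apply, (e.extend 𝓘(ℝ, E)).right_inv hw] using
      hR e he _ (extend_symm_mem_source hw) j k l n
  obtain ⟨y⟩ := (inferInstance : Nonempty M)
  refine ⟨μ y, fun e he q hq i j k l => ?_⟩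
  rw [hR e he q hq, hloc.apply_eq_of_isPreconnected isPreconnected_univ (Set.mem_univ q)
    (Set.mem_univ y)]

end Charts

section WarpedCharts

variable {E B : Type*} [NormedAddCommGroup E] [NormedSpace ℝ E]
  [TopologicalSpace B] [ChartedSpace E B] [IsManifold 𝓘(ℝ, E) ∞ B]
  {E' F : Type*} [NormedAddCommGroup E'] [NormedSpace ℝ E']
  [TopologicalSpace F] [ChartedSpace E' F] [IsManifold 𝓘(ℝ, E') ∞ F]
  {e : OpenPartialHomeomorph B E} {e' : OpenPartialHomeomorph F E'}

theorem hasMFDerivAt_prod_extend_symm (he : e ∈ atlas E B) (he' : e' ∈ atlas E' F) {z : E × E'}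
    (hz : z ∈ (e.extend 𝓘(ℝ, E)).target ×ˢ (e'.extend 𝓘(ℝ, E')).target) :
    HasMFDerivAt 𝓘(ℝ, E × E') (𝓘(ℝ, E).prod 𝓘(ℝ, E'))
      ((e.prod e').extend (𝓘(ℝ, E).prod 𝓘(ℝ, E'))).symm z
      (((mfderiv 𝓘(ℝ, E) 𝓘(ℝ, E) (e.extend 𝓘(ℝ, E)).symm z.1).comp
          (ContinuousLinearMap.fst ℝ E E')).prod
        ((mfderiv 𝓘(ℝ, E') 𝓘(ℝ, E') (e'.extend 𝓘(ℝ, E')).symm z.2).comp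
          (ContinuousLinearMap.snd ℝ E E'))) :=
  ((mdifferentiableAt_extend_symm he hz.1).hasMFDerivAt.comp z
    hasFDerivAt_fst.hasMFDerivAt).prodMk
  ((mdifferentiableAt_extend_symm he' hz.2).hasMFDerivAt.comp z
    hasFDerivAt_snd.hasMFDerivAt)

theorem metricCoord_warpedMetric {ι ι' : Type*} (b : Basis ι ℝ E) (b' : Basis ι' ℝ E')
    (gB : FormField 𝓘(ℝ, E) B) (gF : FormField 𝓘(ℝ, E') F) (f : B → ℝ) (he : e ∈ atlas E B)
    (he' : e' ∈ atlas E' F) {z : E × E'}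
    (hz : z ∈ (e.extend 𝓘(ℝ, E)).target ×ˢ (e'.extend 𝓘(ℝ, E')).target) :
    metricCoord (𝓘(ℝ, E).prod 𝓘(ℝ, E')) (b.prod b')
        (warpedMetric 𝓘(ℝ, E) 𝓘(ℝ, E') gB gF f) (e.prod e') z
      = blockMetric (metricCoord 𝓘(ℝ, E) b gB e) (metricCoord 𝓘(ℝ, E') b' gF e')
          (f ∘ (e.extend 𝓘(ℝ, E)).symm) z := by
  set ψ := (e.extend 𝓘(ℝ, E)).symm
  set ψ' := (e'.extend 𝓘(ℝ, E')).symm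
  have hmetric : ∀ u v : E × E', warpedMetric 𝓘(ℝ, E) 𝓘(ℝ, E') gB gF f (ψ z.1, ψ' z.2)
      (mfderiv 𝓘(ℝ, E × E') (𝓘(ℝ, E).prod 𝓘(ℝ, E'))
        ((e.prod e').extend (𝓘(ℝ, E).prod 𝓘(ℝ, E'))).symm z u)
      (mfderiv 𝓘(ℝ, E × E') (𝓘(ℝ, E).prod 𝓘(ℝ, E'))
        ((e.prod e').extend (𝓘(ℝ, E).prod 𝓘(ℝ, E'))).symm z v)
      = gB (ψ z.1) (mfderiv 𝓘(ℝ, E) 𝓘(ℝ, E) ψ z.1 u.1) (mfderiv 𝓘(ℝ, E) 𝓘(ℝ, E) ψ z.1 v.1)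
        + f (ψ z.1) * gF (ψ' z.2) (mfderiv 𝓘(ℝ, E') 𝓘(ℝ, E') ψ' z.2 u.2)
          (mfderiv 𝓘(ℝ, E') 𝓘(ℝ, E') ψ' z.2 v.2) := by
    intro u v
    rw [(hasMFDerivAt_prod_extend_symm he he' hz).mfderiv]
    simp only [warpedMetric, pullback, mfderiv_fst, mfderiv_snd]
    rfl
  ext i j
  refine (hmetric _ _).trans ?_
  have hzero : mfderiv 𝓘(ℝ, E) 𝓘(ℝ, E) ψ z.1 (0 : E) = 0 := map_zero _
  have hzero' : mfderiv 𝓘(ℝ, E') 𝓘(ℝ, E') ψ' z.2 (0 : E') = 0 := map_zero _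
  rcases i with i | i <;> rcases j with j | j <;>
    simp only [Basis.prod_apply_inl_fst, Basis.prod_apply_inl_snd, Basis.prod_apply_inr_fst,
      Basis.prod_apply_inr_snd, hzero, hzero', map_zero, LinearMap.zero_apply, mul_zero, add_zero,
      zero_add] <;> rfl

end WarpedCharts

/-! ### Generalized Roter type expressions -/

section RoterExpression

variable {ι : Type*} [Fintype ι] [DecidableEq ι] {G S : Matrix ι ι ℝ}

theorem comp_eq_mul (G A B : Matrix ι ι ℝ) : comp G A B = A * G⁻¹ * B := by
  ext i j
  simp only [comp, Matrix.of_apply, Matrix.mul_apply, Finset.sum_mul]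
  rw [Finset.sum_comm]
  exact Finset.sum_congr rfl fun _ _ => Finset.sum_congr rfl fun _ _ => by ring

theorem comp_smul_add_smul_self (hG : IsUnit G.det) (S : Matrix ι ι ℝ) (u v : ℝ) :
    comp G (u • S + v • G) (u • S + v • G)
      = u ^ 2 • comp G S S + (2 * u * v) • S + v ^ 2 • G := by
  have hS : S * G⁻¹ * G = S := by rw [mul_assoc, Matrix.nonsing_inv_mul _ hG, mul_one]
  simp only [comp_eq_mul, add_mul, mul_add, smul_mul_assoc, mul_smul_comm,
    Matrix.mul_nonsing_inv _ hG, hS, one_mul]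
  module

theorem tr_add (G A B : Matrix ι ι ℝ) : tr G (A + B) = tr G A + tr G B := by
  simp [tr, mul_add, Finset.sum_add_distrib]

theorem tr_smul (G A : Matrix ι ι ℝ) (c : ℝ) : tr G (c • A) = c * tr G A := by
  simp [tr, Finset.mul_sum, mul_left_comm]

theorem tr_self (hG : IsUnit G.det) (hsymm : G.IsSymm) : tr G G = Fintype.card ι :=
  calc tr G G = (G⁻¹ * G).trace := by
        simp only [tr, Matrix.trace, Matrix.diag_apply, Matrix.mul_apply, hsymm.apply]
    _ = Fintype.card ι := by rw [Matrix.nonsing_inv_mul _ hG, Matrix.trace_one]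

theorem tr_comp_add_smul (G S T : Matrix ι ι ℝ) (c : ℝ) :
    tr G (comp G (S + c • T) (S + c • T))
      = c * (c * tr G (comp G T T) + tr G (symProd G S T)) + tr G (comp G S S) := by
  simp only [symProd, comp_eq_mul, add_mul, mul_add, smul_mul_assoc, mul_smul_comm, tr_add,
    tr_smul]
  ring

/-- The generalized Roter type expression
`L₁ G∧G + L₂ G∧A + L₃ A∧A + L₄ G∧A² + L₅ A∧A² + L₆ A²∧A²` in a metric `G` and a tensor `A`; the
coefficient `Lᵢ` is the entry `i - 1` of the vector `L`. -/
def roterExpr (L : Fin 6 → ℝ) (G A : Matrix ι ι ℝ) (i j k l : ι) : ℝ :=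
  L 0 * kn G G i j k l + L 1 * kn G A i j k l + L 2 * kn A A i j k l
    + L 3 * kn G (comp G A A) i j k l + L 4 * kn A (comp G A A) i j k l
    + L 5 * kn (comp G A A) (comp G A A) i j k l

/-- The coefficients in `(G, S)` of a generalized Roter type expression in `(G, u S + v G)`. -/
def affineCoeff (u v : ℝ) (L : Fin 6 → ℝ) : Fin 6 → ℝ :=
  ![L 0 + v * L 1 + v ^ 2 * L 2 + v ^ 2 * L 3 + v ^ 3 * L 4 + v ^ 4 * L 5,
    u * L 1 + 2 * u * v * L 2 + 2 * u * v * L 3 + 3 * u * v ^ 2 * L 4 + 4 * u * v ^ 3 * L 5,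
    u ^ 2 * L 2 + 2 * u ^ 2 * v * L 4 + 4 * u ^ 2 * v ^ 2 * L 5,
    u ^ 2 * L 3 + u ^ 2 * v * L 4 + 2 * u ^ 2 * v ^ 2 * L 5,
    u ^ 3 * L 4 + 4 * u ^ 3 * v * L 5,
    u ^ 4 * L 5]

theorem roterExpr_smul (c : ℝ) (L : Fin 6 → ℝ) (G A : Matrix ι ι ℝ) (i j k l : ι) :
    roterExpr (c • L) G A i j k l = c * roterExpr L G A i j k l := by
  simp only [roterExpr, Pi.smul_apply, smul_eq_mul]
  ring

theorem roterExpr_smul_add_smul (hG : IsUnit G.det) (S : Matrix ι ι ℝ) (u v : ℝ) (L : Fin 6 → ℝ) :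
    roterExpr L G (u • S + v • G) = roterExpr (affineCoeff u v L) G S := by
  ext i j k l
  simp only [roterExpr, affineCoeff, comp_smul_add_smul_self hG, kn, Matrix.add_apply,
    Matrix.smul_apply, smul_eq_mul, Matrix.cons_val]
  ring

theorem affineCoeff_zero_left_of_one_le (v : ℝ) (L : Fin 6 → ℝ) {i : Fin 6} (hi : 1 ≤ i) :
    affineCoeff 0 v L i = 0 := by
  fin_cases i <;> simp [affineCoeff] at hi ⊢

/-- The coefficients of a generalized Roter type expression in `(G, S)` when `S² = a S + c G`. -/
def quadraticCoeff (a c : ℝ) (L : Fin 6 → ℝ) : Fin 6 → ℝ :=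
  ![L 0 + c * L 3 + c ^ 2 * L 5, L 1 + a * L 3 + c * L 4 + 2 * a * c * L 5,
    L 2 + a * L 4 + a ^ 2 * L 5, 0, 0, 0]

theorem quadraticCoeff_of_three_le (a c : ℝ) (L : Fin 6 → ℝ) {i : Fin 6} (hi : 3 ≤ i) :
    quadraticCoeff a c L i = 0 := by
  fin_cases i <;> first | rfl | exact absurd hi (by decide)

theorem roterExpr_of_comp_eq {a c : ℝ} (h : comp G S S = a • S + c • G) (L : Fin 6 → ℝ) :
    roterExpr L G S = roterExpr (quadraticCoeff a c L) G S := by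
  ext i j k l
  simp only [roterExpr, quadraticCoeff, h, kn, Matrix.add_apply, Matrix.smul_apply, smul_eq_mul,
    Matrix.cons_val]
  ring

theorem contDiff_affineCoeff :
    ContDiff ℝ ∞ fun p : ℝ × ℝ × (Fin 6 → ℝ) => affineCoeff p.1 p.2.1 p.2.2 := by
  refine contDiff_pi.2 fun i => ?_
  fin_cases i <;>
    simp only [affineCoeff, Fin.zero_eta, Fin.mk_one, Fin.reduceFinMk, Matrix.cons_val] <;> fun_prop

theorem contDiff_quadraticCoeff :
    ContDiff ℝ ∞ fun p : ℝ × ℝ × (Fin 6 → ℝ) => quadraticCoeff p.1 p.2.1 p.2.2 := by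
  refine contDiff_pi.2 fun i => ?_
  fin_cases i <;>
    simp only [quadraticCoeff, Fin.zero_eta, Fin.mk_one, Fin.reduceFinMk, Matrix.cons_val] <;>
    fun_prop

/-- The coefficients of the expression `φ⁻¹ (½ φ² P G∧G + E)` in `(G, S)`, where `E` is the
generalized Roter type expression with coefficients `L` in the metric `φ G` and `S + Q G`. These
are the metric and the Ricci tensor of a warped product along its fiber, and `½ φ² P G∧G` is its
contribution to the curvature tensor there. -/
def fiberCoeff (φ P Q : ℝ) (L : Fin 6 → ℝ) : Fin 6 → ℝ :=
  φ⁻¹ • affineCoeff 1 Q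
    ![φ ^ 2 * (L 0 + 1 / 2 * P), φ * L 1, L 2, L 3, φ⁻¹ * L 4, φ⁻¹ ^ 2 * L 5]

theorem contDiff_fiberCoeff (φ P Q : ℝ) : ContDiff ℝ ∞ (fiberCoeff φ P Q) := by
  have hscaled : ContDiff ℝ ∞ fun L : Fin 6 → ℝ =>
      (![φ ^ 2 * (L 0 + 1 / 2 * P), φ * L 1, L 2, L 3, φ⁻¹ * L 4, φ⁻¹ ^ 2 * L 5] :
        Fin 6 → ℝ) := by
    refine contDiff_pi.2 fun i => ?_
    fin_cases i <;>
      simp only [Fin.zero_eta, Fin.mk_one, Fin.reduceFinMk, Matrix.cons_val] <;> fun_prop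
  exact (contDiff_affineCoeff.comp
    (contDiff_const.prodMk (contDiff_const.prodMk hscaled))).const_smul φ⁻¹

theorem mul_quadraticCoeff_fiberCoeff_two {φ J₁ : ℝ} (hφ : φ ≠ 0) (hJ₁ : J₁ ≠ 0) (J₂ c P Q : ℝ)
    (L : Fin 6 → ℝ) :
    φ * quadraticCoeff (-(J₂ / J₁)) c (fiberCoeff φ P Q L) 2
      = J₂ ^ 2 * L 5 / (φ ^ 2 * J₁ ^ 2) - J₂ * (φ * L 4 + 4 * L 5 * Q) / (φ ^ 2 * J₁)
        + 2 * Q * (φ * L 4 + 2 * L 5 * Q) / φ ^ 2 + L 2 := by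
  simp only [quadraticCoeff, fiberCoeff, affineCoeff, Pi.smul_apply, smul_eq_mul, Matrix.cons_val]
  field_simp
  ring

end RoterExpression

section Weyl

variable {ι : Type*} [Fintype ι] [DecidableEq ι] {G S : Matrix ι ι ℝ}

theorem sum_inv_mul_kn (hG : IsUnit G.det) (hsymm : G.IsSymm) (A : Matrix ι ι ℝ) (j k : ι) :
    ∑ i, ∑ l, G⁻¹ i l * kn G A i j k l
      = ((Fintype.card ι : ℝ) - 2) * A j k + tr G A * G j k := by
  have hraise : ∑ i, ∑ l, G⁻¹ i l * (G i k * A j l) = A j k := by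
    calc _ = (A * (G⁻¹.transpose * G)) j k := by
          simp only [Matrix.mul_apply, Matrix.transpose_apply, Finset.mul_sum]
          rw [Finset.sum_comm]
          exact Finset.sum_congr rfl fun _ _ => Finset.sum_congr rfl fun _ _ => by ring
      _ = A j k := by
          rw [Matrix.transpose_nonsing_inv, hsymm.eq, Matrix.nonsing_inv_mul _ hG, mul_one]
  have hlower : ∑ i, ∑ l, G⁻¹ i l * (G j l * A i k) = A j k := by
    calc _ = (G * G⁻¹.transpose * A) j k := by
          simp only [Matrix.mul_apply, Matrix.transpose_apply, Finset.sum_mul]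
          exact Finset.sum_congr rfl fun _ _ => Finset.sum_congr rfl fun _ _ => by ring
      _ = A j k := by
          rw [Matrix.transpose_nonsing_inv, hsymm.eq, Matrix.mul_nonsing_inv _ hG, one_mul]
  have htrace : ∀ B C : Matrix ι ι ℝ,
      ∑ i, ∑ l, G⁻¹ i l * (B i l * C j k) = tr G B * C j k := fun B C => by
    simp only [tr, Finset.sum_mul, mul_assoc]
  have hcomm : ∀ i l, G⁻¹ i l * (G j k * A i l) = G⁻¹ i l * (A i l * G j k) := fun i l => by
    rw [mul_comm (G j k)]
  simp only [kn, mul_add, mul_sub, Finset.sum_add_distrib, Finset.sum_sub_distrib, hcomm, hraise,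
    hlower, htrace, tr_self hG hsymm]
  ring

theorem weyl_eq_zero_of_eq_kn (hG : IsUnit G.det) (hsymm : G.IsSymm) (hι : 3 ≤ Fintype.card ι)
    {R : ι → ι → ι → ι → ℝ} (hS : ∀ j k, S j k = ∑ i, ∑ l, G⁻¹ i l * R i j k l) {N₁ N₂ : ℝ}
    (hR : ∀ i j k l, R i j k l = N₁ * kn G G i j k l + N₂ * kn G S i j k l) (i j k l : ι) :
    R i j k l - 1 / ((Fintype.card ι : ℝ) - 2) * kn G S i j k l
      + tr G S / (2 * ((Fintype.card ι : ℝ) - 1) * ((Fintype.card ι : ℝ) - 2))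
        * kn G G i j k l = 0 := by
  have hd : (3 : ℝ) ≤ Fintype.card ι := by exact_mod_cast hι
  set d : ℝ := (Fintype.card ι : ℝ)
  have hd2 : d - 2 ≠ 0 := by linarith
  have hd1 : d - 1 ≠ 0 := by linarith
  have hricci : (1 - N₂ * (d - 2)) • S = (2 * (d - 1) * N₁ + N₂ * tr G S) • G := by
    ext j k
    have hcontract : S j k = N₁ * ∑ i, ∑ l, G⁻¹ i l * kn G G i j k l
        + N₂ * ∑ i, ∑ l, G⁻¹ i l * kn G S i j k l := by
      simp only [hS j k, hR, Finset.mul_sum, ← Finset.sum_add_distrib]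
      exact Finset.sum_congr rfl fun _ _ => Finset.sum_congr rfl fun _ _ => by ring
    rw [sum_inv_mul_kn hG hsymm, sum_inv_mul_kn hG hsymm, tr_self hG hsymm] at hcontract
    simp only [Matrix.smul_apply, smul_eq_mul]
    linear_combination hcontract
  have htrace := congrArg (tr G) hricci
  rw [tr_smul, tr_smul, tr_self hG hsymm] at htrace
  have hkn : (1 - N₂ * (d - 2)) * kn G S i j k l
      = (2 * (d - 1) * N₁ + N₂ * tr G S) * kn G G i j k l := by
    have hentry := fun a b => congrFun₂ hricci a b
    simp only [Matrix.smul_apply, smul_eq_mul] at hentry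
    simp only [kn]
    linear_combination G i l * hentry j k + G j k * hentry i l - G i k * hentry j l
      - G j l * hentry i k
  rw [hR]
  field_simp
  linear_combination -(2 * (d - 1)) * hkn + kn G G i j k l * htrace

end Weyl

namespace IsWarpedOn

open Sum

variable {ι E : Type*} [Fintype ι] [DecidableEq ι] [NormedAddCommGroup E] [NormedSpace ℝ E]
  {ι' E' : Type*} [Fintype ι'] [DecidableEq ι'] [NormedAddCommGroup E'] [NormedSpace ℝ E']
  {g : E → Matrix ι ι ℝ} {s : Set E} {g' : E' → Matrix ι' ι' ℝ} {t : Set E'} {f : E → ℝ}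
  {z : E × E'}

theorem ricci_blockMetric (b : Basis ι ℝ E) (b' : Basis ι' ℝ E') (H : IsWarpedOn g s g' t f)
    (hz : z ∈ s ×ˢ t) : ricci (b.prod b') (blockMetric g g' f) z
      = Matrix.fromBlocks (ricci b g z.1 + (Fintype.card ι' : ℝ) • tensorT b g f z.1) 0 0
          (ricci b' g' z.2 + (f z.1 * (tr (g z.1) (tensorT b g f z.1)
            - ((Fintype.card ι' : ℝ) - 1) * scalarP b g f z.1)) • g' z.2) := by
  ext i j
  rcases i with i | i <;> rcases j with j | j
  · simp [H.ricci_base b b' hz]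
  · simp [H.ricci_mixed b b' hz]
  · simp [H.ricci_mixed' b b' hz]
  · simp [H.ricci_fiber b b' hz]

variable (A : Matrix ι ι ℝ) (X : Matrix ι' ι' ℝ) (L : Fin 6 → ℝ)

theorem comp_blockMetric (H : IsWarpedOn g s g' t f) (hz : z ∈ s ×ˢ t) :
    comp (blockMetric g g' f z) (Matrix.fromBlocks A 0 0 X) (Matrix.fromBlocks A 0 0 X)
      = Matrix.fromBlocks (comp (g z.1) A A) 0 0 ((f z.1)⁻¹ • comp (g' z.2) X X) := by
  simp [comp_eq_mul, H.inv_blockMetric hz, Matrix.fromBlocks_multiply]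

theorem roterExpr_base (H : IsWarpedOn g s g' t f) (hz : z ∈ s ×ˢ t) (i j k l : ι) :
    roterExpr L (blockMetric g g' f z) (Matrix.fromBlocks A 0 0 X) (inl i) (inl j) (inl k) (inl l)
      = roterExpr L (g z.1) A i j k l := by
  simp only [roterExpr, H.comp_blockMetric A X hz]
  simp only [kn, blockMetric, Matrix.fromBlocks_apply₁₁]

theorem roterExpr_fiber (H : IsWarpedOn g s g' t f) (hz : z ∈ s ×ˢ t) (P Q : ℝ)
    (i j k l : ι') :
    f z.1 ^ 2 * P * (1 / 2 * kn (g' z.2) (g' z.2) i j k l)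
      + roterExpr L (blockMetric g g' f z) (Matrix.fromBlocks A 0 0 (X + Q • g' z.2))
        (inr i) (inr j) (inr k) (inr l)
      = f z.1 * roterExpr (fiberCoeff (f z.1) P Q L) (g' z.2) X i j k l := by
  have hφ := H.ne_zero z.1 hz.1
  rw [fiberCoeff, roterExpr_smul, mul_inv_cancel_left₀ hφ,
    ← roterExpr_smul_add_smul (H.fiber.isUnit _ hz.2), one_smul]
  simp only [roterExpr, H.comp_blockMetric A (X + Q • g' z.2) hz]
  simp only [kn, blockMetric, Matrix.fromBlocks_apply₂₂, Matrix.cons_val, Matrix.smul_apply,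
    smul_eq_mul]
  field_simp
  ring

theorem tr_roterExpr_mixed (H : IsWarpedOn g s g' t f) (hz : z ∈ s ×ˢ t) (β γ : ι') :
    tr (g z.1) (Matrix.of fun a d => roterExpr L (blockMetric g g' f z)
        (Matrix.fromBlocks A 0 0 X) (inl a) (inr β) (inr γ) (inl d))
      = (2 * Fintype.card ι * L 0 + tr (g z.1) A * L 1 + tr (g z.1) (comp (g z.1) A A) * L 3)
          * (f z.1 * g' z.2 β γ)
        + (Fintype.card ι * L 1 + 2 * tr (g z.1) A * L 2 + tr (g z.1) (comp (g z.1) A A) * L 4)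
          * X β γ
        + (Fintype.card ι * L 3 + tr (g z.1) A * L 4 + 2 * tr (g z.1) (comp (g z.1) A A) * L 5)
          * ((f z.1)⁻¹ * comp (g' z.2) X X β γ) := by
  set G' := f z.1 * g' z.2 β γ
  set X2 := (f z.1)⁻¹ * comp (g' z.2) X X β γ
  have hmixed : (Matrix.of fun a d => roterExpr L (blockMetric g g' f z)
        (Matrix.fromBlocks A 0 0 X) (inl a) (inr β) (inr γ) (inl d))
      = (2 * L 0 * G' + L 1 * X β γ + L 3 * X2) • g z.1
        + (L 1 * G' + 2 * L 2 * X β γ + L 4 * X2) • A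
        + (L 3 * G' + L 4 * X β γ + 2 * L 5 * X2) • comp (g z.1) A A := by
    ext a d
    simp only [Matrix.of_apply, roterExpr, H.comp_blockMetric A X hz]
    simp only [kn, blockMetric, Matrix.fromBlocks_apply₁₁, Matrix.fromBlocks_apply₂₂,
      Matrix.fromBlocks_apply₁₂, Matrix.fromBlocks_apply₂₁, Matrix.zero_apply, Matrix.add_apply,
      Matrix.smul_apply, smul_eq_mul, G', X2]
    ring
  rw [hmixed, tr_add, tr_add, tr_smul, tr_smul, tr_smul,
    tr_self (H.base.isUnit _ hz.1) (H.base.symm _ hz.1)]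
  ring

theorem fiber_ricci_relation (b : Basis ι ℝ E) (b' : Basis ι' ℝ E') {A : Matrix ι ι ℝ}
    {X : Matrix ι' ι' ℝ} {L : Fin 6 → ℝ} (H : IsWarpedOn g s g' t f) (hz : z ∈ s ×ˢ t)
    (hR : riem (b.prod b') (blockMetric g g' f) z
      = roterExpr L (blockMetric g g' f z) (Matrix.fromBlocks A 0 0 X)) :
    (tr (g z.1) (tensorT b g f z.1) * f z.1) • g' z.2
      = ((2 * Fintype.card ι * L 0 + tr (g z.1) A * L 1 + tr (g z.1) (comp (g z.1) A A) * L 3)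
          * f z.1) • g' z.2
        + (Fintype.card ι * L 1 + 2 * tr (g z.1) A * L 2 + tr (g z.1) (comp (g z.1) A A) * L 4)
          • X
        + ((Fintype.card ι * L 3 + tr (g z.1) A * L 4 + 2 * tr (g z.1) (comp (g z.1) A A) * L 5)
          * (f z.1)⁻¹) • comp (g' z.2) X X := by
  ext β γ
  have hmixed : (Matrix.of fun a d => riem (b.prod b') (blockMetric g g' f) z
        (inl a) (inr β) (inr γ) (inl d))
      = (f z.1 * g' z.2 β γ) • tensorT b g f z.1 := by
    ext a d
    simp only [Matrix.of_apply, H.riem_base_fiber_fiber_base b b' hz, Matrix.smul_apply,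
      smul_eq_mul]
    ring
  rw [hR] at hmixed
  have htrace := congrArg (tr (g z.1)) hmixed
  rw [H.tr_roterExpr_mixed A X L hz, tr_smul] at htrace
  simp only [Matrix.add_apply, Matrix.smul_apply, smul_eq_mul]
  linear_combination -htrace

end IsWarpedOn

/-! ### Warped products of generalized Roter type -/

section RoterExpansion

variable {ι E H M : Type*} [Fintype ι] [DecidableEq ι] [NormedAddCommGroup E] [NormedSpace ℝ E]
  [TopologicalSpace H] [TopologicalSpace M] [ChartedSpace H M]

/-- The curvature tensor of `g` is the generalized Roter type expression with the smooth vector of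
coefficients `L`; the coefficient `Lᵢ` of `IsGRTWith` is the entry `i - 1`. -/
structure IsRoterExpansion (I : ModelWithCorners ℝ E H) (b : Basis ι ℝ E) (g : FormField I M)
    (L : M → Fin 6 → ℝ) : Prop where
  smooth : ContMDiff I 𝓘(ℝ, Fin 6 → ℝ) ∞ L
  riem_eq : ∀ e ∈ atlas H M, ∀ q ∈ e.source,
    rAt I b g e q = roterExpr (L q) (gAt I b g e q) (sAt I b g e q)

/-- The linear relation `α S² + β S + γ g = 0` with smooth coefficients. -/
structure IsRicciRelation (I : ModelWithCorners ℝ E H) (b : Basis ι ℝ E) (g : FormField I M)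
    (α β γ : M → ℝ) : Prop where
  smooth : IsScalar I α ∧ IsScalar I β ∧ IsScalar I γ
  eq_zero : ∀ e ∈ atlas H M, ∀ q ∈ e.source,
    α q • s2At I b g e q + β q • sAt I b g e q + γ q • gAt I b g e q = 0

variable {I : ModelWithCorners ℝ E H} {b : Basis ι ℝ E} {g : FormField I M}

theorem IsScalar.neg_div {u v : M → ℝ} (hu : IsScalar I u) (hv : IsScalar I v)
    (hv0 : ∀ q, v q ≠ 0) : IsScalar I fun q => -(u q / v q) :=
  ContMDiff.neg (ContMDiff.div₀ hu hv hv0)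

theorem IsGRTWith.isRoterExpansion {L₁ L₂ L₃ L₄ L₅ L₆ : M → ℝ}
    (h : IsGRTWith I b g L₁ L₂ L₃ L₄ L₅ L₆)
    (hL : ∀ L ∈ [L₁, L₂, L₃, L₄, L₅, L₆], IsScalar I L) :
    IsRoterExpansion I b g fun q => ![L₁ q, L₂ q, L₃ q, L₄ q, L₅ q, L₆ q] where
  smooth := by
    refine contMDiff_pi_space.2 fun i => hL _ ?_
    fin_cases i <;> simp
  riem_eq e he q hq := by
    ext i j k l
    exact h e he q hq i j k l

namespace IsRoterExpansion

variable {L : M → Fin 6 → ℝ}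

theorem isScalar (h : IsRoterExpansion I b g L) (i : Fin 6) : IsScalar I fun q => L q i :=
  contMDiff_pi_space.1 h.smooth i

theorem isGRT (h : IsRoterExpansion I b g L) : IsGRT I b g :=
  ⟨_, _, _, _, _, _, ⟨h.isScalar 0, h.isScalar 1, h.isScalar 2, h.isScalar 3, h.isScalar 4,
    h.isScalar 5⟩, fun e he q hq i j k l => by rw [h.riem_eq e he q hq]; rfl⟩

theorem isRoter (h : IsRoterExpansion I b g L) (hL : ∀ q, ∀ i ≥ 3, L q i = 0) : IsRoter I b g :=
  ⟨_, _, _, ⟨h.isScalar 0, h.isScalar 1, h.isScalar 2⟩, fun e he q hq i j k l => by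
    simp [h.riem_eq e he q hq, roterExpr, hL q 3, hL q 4, hL q 5]⟩

theorem isConformallyFlat (h : IsRoterExpansion I b g L) (hL : ∀ q, ∀ i ≥ 2, L q i = 0) :
    IsConformallyFlat I b g :=
  ⟨_, _, ⟨h.isScalar 0, h.isScalar 1⟩, fun e he q hq i j k l => by
    simp [h.riem_eq e he q hq, roterExpr, hL q 2, hL q 3, hL q 4, hL q 5]⟩

theorem hasPointwiseConstantCurvature (h : IsRoterExpansion I b g L)
    (hL : ∀ q, ∀ i ≥ 1, L q i = 0) : HasPointwiseConstantCurvature I b g :=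
  ⟨fun q => 2 * L q 0, contMDiff_const.mul (h.isScalar 0), fun e he q hq i j k l => by
    rw [h.riem_eq e he q hq, roterExpr, hL q 1 (by decide), hL q 2 (by decide),
      hL q 3 (by decide), hL q 4 (by decide), hL q 5 (by decide)]
    ring⟩

theorem of_s2At_eq {a c : M → ℝ} (h : IsRoterExpansion I b g L) (ha : IsScalar I a)
    (hc : IsScalar I c)
    (hS : ∀ e ∈ atlas H M, ∀ q ∈ e.source,
      s2At I b g e q = a q • sAt I b g e q + c q • gAt I b g e q) :
    IsRoterExpansion I b g fun q => quadraticCoeff (a q) (c q) (L q) where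
  smooth := contDiff_quadraticCoeff.comp_contMDiff (ha.prodMk_space (hc.prodMk_space h.smooth))
  riem_eq e he q hq := by rw [h.riem_eq e he q hq, roterExpr_of_comp_eq (hS e he q hq)]

end IsRoterExpansion

namespace IsRicciRelation

variable {α β γ : M → ℝ}

theorem isEin2 (h : IsRicciRelation I b g α β γ) (hα : ∀ q, α q ≠ 0) : IsEin2 I b g :=
  ⟨α, β, γ, h.smooth, fun q => Or.inl (hα q), h.eq_zero⟩

theorem s2At_eq (h : IsRicciRelation I b g α β γ) (hα : ∀ q, α q ≠ 0)
    {e : OpenPartialHomeomorph M H} (he : e ∈ atlas H M) {q : M} (hq : q ∈ e.source) :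
    s2At I b g e q = -(β q / α q) • sAt I b g e q + -(γ q / α q) • gAt I b g e q := by
  rw [← smul_right_inj (hα q), ← sub_eq_zero, ← h.eq_zero e he q hq, smul_add, smul_smul,
    smul_smul, mul_neg, mul_neg, mul_div_cancel₀ _ (hα q), mul_div_cancel₀ _ (hα q)]
  module

theorem sAt_eq (h : IsRicciRelation I b g α β γ) (hα : ∀ q, α q = 0) (hβ : ∀ q, β q ≠ 0)
    {e : OpenPartialHomeomorph M H} (he : e ∈ atlas H M) {q : M} (hq : q ∈ e.source) :
    sAt I b g e q = -(γ q / β q) • gAt I b g e q := by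
  have hrel := h.eq_zero e he q hq
  rw [hα q, zero_smul, zero_add] at hrel
  rw [← smul_right_inj (hβ q), ← sub_eq_zero, ← hrel, smul_smul, mul_neg,
    mul_div_cancel₀ _ (hβ q)]
  module

theorem isRoterExpansion {L : M → Fin 6 → ℝ} (h : IsRicciRelation I b g α β γ)
    (hα : ∀ q, α q ≠ 0) (hL : IsRoterExpansion I b g L) :
    IsRoterExpansion I b g fun q => quadraticCoeff (-(β q / α q)) (-(γ q / α q)) (L q) :=
  hL.of_s2At_eq (h.smooth.2.1.neg_div h.smooth.1 hα) (h.smooth.2.2.neg_div h.smooth.1 hα)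
    fun _ he _ hq => h.s2At_eq hα he hq

theorem isRoter {L : M → Fin 6 → ℝ} (h : IsRicciRelation I b g α β γ) (hα : ∀ q, α q ≠ 0)
    (hL : IsRoterExpansion I b g L) : IsRoter I b g :=
  (h.isRoterExpansion hα hL).isRoter fun _ _ => quadraticCoeff_of_three_le _ _ _

theorem isConformallyFlat {L : M → Fin 6 → ℝ} (h : IsRicciRelation I b g α β γ)
    (hα : ∀ q, α q ≠ 0) (hL : IsRoterExpansion I b g L)
    (hL₂ : ∀ q, quadraticCoeff (-(β q / α q)) (-(γ q / α q)) (L q) 2 = 0) :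
    IsConformallyFlat I b g :=
  (h.isRoterExpansion hα hL).isConformallyFlat fun q i hi => by
    obtain rfl | hi := hi.eq_or_lt
    · exact hL₂ q
    · exact quadraticCoeff_of_three_le _ _ _ (Fin.add_one_le_of_lt hi)

end IsRicciRelation

end RoterExpansion

theorem IsSemiRiemannian.isSymm_gAt {ι E H M : Type*} [NormedAddCommGroup E] [NormedSpace ℝ E]
    [TopologicalSpace H] [TopologicalSpace M] [ChartedSpace H M] {I : ModelWithCorners ℝ E H}
    {b : Basis ι ℝ E} {g : FormField I M} (hg : IsSemiRiemannian I b g)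
    (e : OpenPartialHomeomorph M H) (q : M) : (gAt I b g e q).IsSymm :=
  Matrix.IsSymm.ext fun _ _ => hg.symm _ _ _

section ModelSpaceCharts

variable {ι E M : Type*} [Fintype ι] [DecidableEq ι] [NormedAddCommGroup E] [NormedSpace ℝ E]
  [TopologicalSpace M] [ChartedSpace E M]
  {b : Basis ι ℝ E} {g : FormField 𝓘(ℝ, E) M}

theorem hasConstantCurvature_of_subsingleton [Subsingleton ι]
    (h : HasPointwiseConstantCurvature 𝓘(ℝ, E) b g) : HasConstantCurvature 𝓘(ℝ, E) b g := by
  obtain ⟨μ, -, hμ⟩ := h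
  refine ⟨0, fun e he q hq i j k l => ?_⟩
  rw [hμ e he q hq, Subsingleton.elim j i, Subsingleton.elim k i, Subsingleton.elim l i,
    half_kn_self]
  ring

variable [IsManifold 𝓘(ℝ, E) ∞ M]

theorem HasPointwiseConstantCurvature.hasConstantCurvature_of_card_ne_two [ConnectedSpace M]
    (h : HasPointwiseConstantCurvature 𝓘(ℝ, E) b g) (hg : IsSemiRiemannian 𝓘(ℝ, E) b g)
    (hι : Fintype.card ι ≠ 2) : HasConstantCurvature 𝓘(ℝ, E) b g := by
  obtain hle | hge : Fintype.card ι ≤ 1 ∨ 3 ≤ Fintype.card ι := by omega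
  · have := Fintype.card_le_one_iff_subsingleton.1 hle
    exact hasConstantCurvature_of_subsingleton h
  · exact h.hasConstantCurvature hg hge

variable {e : OpenPartialHomeomorph M E} {q : M}

theorem IsSemiRiemannian.isUnit_det_gAt (hg : IsSemiRiemannian 𝓘(ℝ, E) b g) (he : e ∈ atlas E M)
    (hq : q ∈ e.source) : IsUnit (gAt 𝓘(ℝ, E) b g e q).det :=
  (hg.isMetricOn he).isUnit _ (extend_mem_target hq)

theorem IsConformallyFlat.weylVanishes (h : IsConformallyFlat 𝓘(ℝ, E) b g)
    (hg : IsSemiRiemannian 𝓘(ℝ, E) b g) (hι : 3 ≤ Fintype.card ι) :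
    WeylVanishes 𝓘(ℝ, E) b g := by
  obtain ⟨N₁, N₂, -, hN⟩ := h
  exact fun e he q hq => weyl_eq_zero_of_eq_kn (hg.isUnit_det_gAt he hq) (hg.isSymm_gAt e q) hι
    (fun _ _ => rfl) (hN e he q hq)

theorem IsRoterExpansion.of_sAt_eq {L : M → Fin 6 → ℝ} {c : M → ℝ}
    (h : IsRoterExpansion 𝓘(ℝ, E) b g L) (hg : IsSemiRiemannian 𝓘(ℝ, E) b g)
    (hc : IsScalar 𝓘(ℝ, E) c)
    (hS : ∀ e ∈ atlas E M, ∀ q ∈ e.source, sAt 𝓘(ℝ, E) b g e q = c q • gAt 𝓘(ℝ, E) b g e q) :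
    IsRoterExpansion 𝓘(ℝ, E) b g fun q => affineCoeff 0 (c q) (L q) where
  smooth := contDiff_affineCoeff.comp_contMDiff
    (contMDiff_const.prodMk_space (hc.prodMk_space h.smooth))
  riem_eq e he q hq := by
    rw [h.riem_eq e he q hq, ← roterExpr_smul_add_smul (hg.isUnit_det_gAt he hq), zero_smul,
      zero_add, hS e he q hq]

theorem isEinstein_of_sAt_eq {c : M → ℝ} (hg : IsSemiRiemannian 𝓘(ℝ, E) b g)
    (hS : ∀ e ∈ atlas E M, ∀ q ∈ e.source, sAt 𝓘(ℝ, E) b g e q = c q • gAt 𝓘(ℝ, E) b g e q) :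
    IsEinstein 𝓘(ℝ, E) b g := by
  intro e he q hq
  have hscal : scalAt 𝓘(ℝ, E) b g e q = c q * Fintype.card ι := by
    rw [scalAt, hS e he q hq, tr_smul,
      tr_self (hg.isUnit_det_gAt he hq) (hg.isSymm_gAt e q)]
  ext i j
  have : Nonempty ι := ⟨i⟩
  have hι : (Fintype.card ι : ℝ) ≠ 0 := Nat.cast_ne_zero.2 Fintype.card_ne_zero
  rw [hscal, mul_div_cancel_right₀ _ hι, hS e he q hq]

theorem IsRicciRelation.hasPointwiseConstantCurvature {L : M → Fin 6 → ℝ} {α β γ : M → ℝ}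
    (h : IsRicciRelation 𝓘(ℝ, E) b g α β γ) (hg : IsSemiRiemannian 𝓘(ℝ, E) b g)
    (hα : ∀ q, α q = 0) (hβ : ∀ q, β q ≠ 0) (hL : IsRoterExpansion 𝓘(ℝ, E) b g L) :
    HasPointwiseConstantCurvature 𝓘(ℝ, E) b g :=
  (hL.of_sAt_eq hg (h.smooth.2.2.neg_div h.smooth.2.1 hβ)
    fun _ he _ hq => h.sAt_eq hα hβ he hq).hasPointwiseConstantCurvature
      fun _ _ hi => affineCoeff_zero_left_of_one_le _ _ hi

theorem IsRicciRelation.isEinstein {α β γ : M → ℝ} (h : IsRicciRelation 𝓘(ℝ, E) b g α β γ)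
    (hg : IsSemiRiemannian 𝓘(ℝ, E) b g) (hα : ∀ q, α q = 0) (hβ : ∀ q, β q ≠ 0) :
    IsEinstein 𝓘(ℝ, E) b g :=
  isEinstein_of_sAt_eq hg fun _ he _ hq => h.sAt_eq hα hβ he hq

end ModelSpaceCharts

section WarpedProduct

variable {ι E B : Type*} [Fintype ι] [DecidableEq ι] [NormedAddCommGroup E] [NormedSpace ℝ E]
  [TopologicalSpace B] [ChartedSpace E B]
  {ι' E' F : Type*} [Fintype ι'] [DecidableEq ι'] [NormedAddCommGroup E'] [NormedSpace ℝ E']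
  [TopologicalSpace F] [ChartedSpace E' F]

/-- The data of a warped product with base metric `gB`, fiber metric `gF` and warping function
`f`, which may have either sign. -/
structure IsWarpedProduct (b : Basis ι ℝ E) (b' : Basis ι' ℝ E') (gB : FormField 𝓘(ℝ, E) B)
    (gF : FormField 𝓘(ℝ, E') F) (f : B → ℝ) : Prop where
  base : IsSemiRiemannian 𝓘(ℝ, E) b gB
  fiber : IsSemiRiemannian 𝓘(ℝ, E') b' gF
  smooth : IsScalar 𝓘(ℝ, E) f
  ne_zero : ∀ x, f x ≠ 0

/-- The scalar for which `J₁ S̃² + J₂ S̃ + J₃ g̃ = 0` on the fiber of a warped product with the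
coefficients `L`. -/
def ricciRelationCoeff (b : Basis ι ℝ E) (gB : FormField 𝓘(ℝ, E) B) (f : B → ℝ) (m : ℕ)
    (L : B × F → Fin 6 → ℝ) (q : B × F) : ℝ :=
  let ρ := rBase 𝓘(ℝ, E) b gB q.1 + m * trT 𝓘(ℝ, E) b gB f q.1
  let Θ := bracketBase 𝓘(ℝ, E) b gB f m q.1
  let Q := scalarQ 𝓘(ℝ, E) b gB f m q.1
  f q.1 * trT 𝓘(ℝ, E) b gB f q.1
    - f q.1 * (2 * Fintype.card ι * L q 0 + ρ * L q 1 + Θ * L q 3)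
    - Q * (Fintype.card ι * L q 1 + 2 * ρ * L q 2 + Θ * L q 4)
    - Q ^ 2 * (Fintype.card ι * L q 3 + ρ * L q 4 + 2 * Θ * L q 5) / f q.1

variable [IsManifold 𝓘(ℝ, E) ∞ B] [IsManifold 𝓘(ℝ, E') ∞ F]
  {b : Basis ι ℝ E} {b' : Basis ι' ℝ E'} {gB : FormField 𝓘(ℝ, E) B} {gF : FormField 𝓘(ℝ, E') F}
  {f : B → ℝ} {L : B × F → Fin 6 → ℝ}
  {e : OpenPartialHomeomorph B E} {e' : OpenPartialHomeomorph F E'}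

theorem IsRoterExpansion.riem_blockMetric
    (hL : IsRoterExpansion (𝓘(ℝ, E).prod 𝓘(ℝ, E')) (b.prod b')
      (warpedMetric 𝓘(ℝ, E) 𝓘(ℝ, E') gB gF f) L)
    (he : e ∈ atlas E B) (he' : e' ∈ atlas E' F) {x : B} {y : F} (hx : x ∈ e.source)
    (hy : y ∈ e'.source) {G : E × E' → Matrix (ι ⊕ ι') (ι ⊕ ι') ℝ}
    (hG : G = blockMetric (metricCoord 𝓘(ℝ, E) b gB e) (metricCoord 𝓘(ℝ, E') b' gF e')
      (f ∘ (e.extend 𝓘(ℝ, E)).symm)) :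
    riem (b.prod b') G (e.extend 𝓘(ℝ, E) x, e'.extend 𝓘(ℝ, E') y)
      = roterExpr (L (x, y)) (G (e.extend 𝓘(ℝ, E) x, e'.extend 𝓘(ℝ, E') y))
        (ricci (b.prod b') G (e.extend 𝓘(ℝ, E) x, e'.extend 𝓘(ℝ, E') y)) := by
  have hev : metricCoord (𝓘(ℝ, E).prod 𝓘(ℝ, E')) (b.prod b')
      (warpedMetric 𝓘(ℝ, E) 𝓘(ℝ, E') gB gF f) (e.prod e')
      =ᶠ[nhds (e.extend 𝓘(ℝ, E) x, e'.extend 𝓘(ℝ, E') y)] G :=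
    Filter.eventuallyEq_of_mem
      ((e.isOpen_extend_target.prod e'.isOpen_extend_target).mem_nhds
        ⟨extend_mem_target hx, extend_mem_target hy⟩)
      fun w hw => hG ▸ metricCoord_warpedMetric b b' gB gF f he he' hw
  rw [← riem_congr _ hev, ← ricci_congr _ hev, ← hev.eq_of_nhds]
  exact hL.riem_eq (e.prod e') (Set.mem_image2_of_mem he he') (x, y) ⟨hx, hy⟩

namespace IsWarpedProduct

theorem isWarpedOn (H : IsWarpedProduct b b' gB gF f) (he : e ∈ atlas E B)
    (he' : e' ∈ atlas E' F) :
    IsWarpedOn (metricCoord 𝓘(ℝ, E) b gB e) (e.extend 𝓘(ℝ, E)).target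
      (metricCoord 𝓘(ℝ, E') b' gF e') (e'.extend 𝓘(ℝ, E')).target
      (f ∘ (e.extend 𝓘(ℝ, E)).symm) where
  base := H.base.isMetricOn he
  fiber := H.fiber.isMetricOn he'
  smooth := H.smooth.contDiffOn_comp_extend_symm he
  ne_zero _ _ := H.ne_zero _

theorem fiber_roterExpansion (H : IsWarpedProduct b b' gB gF f)
    (hL : IsRoterExpansion (𝓘(ℝ, E).prod 𝓘(ℝ, E')) (b.prod b')
      (warpedMetric 𝓘(ℝ, E) 𝓘(ℝ, E') gB gF f) L) (x : B) :
    IsRoterExpansion 𝓘(ℝ, E') b' gF fun y =>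
      fiberCoeff (f x) (pAt 𝓘(ℝ, E) b gB f (chartAt E x) x)
        (scalarQ 𝓘(ℝ, E) b gB f (Fintype.card ι') x) (L (x, y)) where
  smooth := (contDiff_fiberCoeff _ _ _).comp_contMDiff
    (hL.smooth.comp (contMDiff_const.prodMk contMDiff_id))
  riem_eq e' he' y hy := by
    have he := chart_mem_atlas E x
    have hx := mem_chart_source E x
    have hz := Set.mk_mem_prod (extend_mem_target hx) (extend_mem_target hy)
    have hfx : (f ∘ ((chartAt E x).extend 𝓘(ℝ, E)).symm) ((chartAt E x).extend 𝓘(ℝ, E) x) = f x :=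
      congrArg f ((chartAt E x).extend_left_inv hx)
    have W := H.isWarpedOn he he'
    ext i j k l
    have hR := congrFun (congrFun (congrFun (congrFun
      (hL.riem_blockMetric he he' hx hy rfl) (Sum.inr i)) (Sum.inr j)) (Sum.inr k)) (Sum.inr l)
    rw [W.riem_fiber b b' hz, W.ricci_blockMetric b b' hz, sub_eq_iff_eq_add',
      W.roterExpr_fiber _ _ _ hz, hfx] at hR
    exact mul_left_cancel₀ (H.ne_zero x) hR

theorem fiber_ricci_relation_at (H : IsWarpedProduct b b' gB gF f)
    (hL : IsRoterExpansion (𝓘(ℝ, E).prod 𝓘(ℝ, E')) (b.prod b')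
      (warpedMetric 𝓘(ℝ, E) 𝓘(ℝ, E') gB gF f) L) (x : B) (he' : e' ∈ atlas E' F) {y : F}
    (hy : y ∈ e'.source) {ρ Θ Q : ℝ}
    (hρ : ρ = rBase 𝓘(ℝ, E) b gB x + Fintype.card ι' * trT 𝓘(ℝ, E) b gB f x)
    (hΘ : Θ = bracketBase 𝓘(ℝ, E) b gB f (Fintype.card ι') x)
    (hQ : Q = scalarQ 𝓘(ℝ, E) b gB f (Fintype.card ι') x) :
    (trT 𝓘(ℝ, E) b gB f x * f x) • gAt 𝓘(ℝ, E') b' gF e' y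
      = ((2 * Fintype.card ι * L (x, y) 0 + ρ * L (x, y) 1 + Θ * L (x, y) 3) * f x)
          • gAt 𝓘(ℝ, E') b' gF e' y
        + (Fintype.card ι * L (x, y) 1 + 2 * ρ * L (x, y) 2 + Θ * L (x, y) 4)
          • (sAt 𝓘(ℝ, E') b' gF e' y + Q • gAt 𝓘(ℝ, E') b' gF e' y)
        + ((Fintype.card ι * L (x, y) 3 + ρ * L (x, y) 4 + 2 * Θ * L (x, y) 5) * (f x)⁻¹)
          • (s2At 𝓘(ℝ, E') b' gF e' y + (2 * Q) • sAt 𝓘(ℝ, E') b' gF e' y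
            + Q ^ 2 • gAt 𝓘(ℝ, E') b' gF e' y) := by
  have he := chart_mem_atlas E x
  have hx := mem_chart_source E x
  have hz := Set.mk_mem_prod (extend_mem_target hx) (extend_mem_target hy)
  have hfx : (f ∘ ((chartAt E x).extend 𝓘(ℝ, E)).symm) ((chartAt E x).extend 𝓘(ℝ, E) x) = f x :=
    congrArg f ((chartAt E x).extend_left_inv hx)
  have W := H.isWarpedOn he he'
  have hcomp := comp_smul_add_smul_self (H.fiber.isUnit_det_gAt he' hy)
    (sAt 𝓘(ℝ, E') b' gF e' y) 1 Q
  have hR := W.fiber_ricci_relation b b' hz (L := L (x, y))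
    ((hL.riem_blockMetric he he' hx hy rfl).trans (by rw [W.ricci_blockMetric b b' hz]))
  rw [hfx, tr_add, tr_smul, tr_comp_add_smul] at hR
  simp only [one_smul, one_pow, mul_one] at hcomp
  rw [s2At, ← hcomp, hρ, hΘ, hQ]
  exact hR

theorem fiber_ricciRelation (H : IsWarpedProduct b b' gB gF f)
    (hL : IsRoterExpansion (𝓘(ℝ, E).prod 𝓘(ℝ, E')) (b.prod b')
      (warpedMetric 𝓘(ℝ, E) 𝓘(ℝ, E') gB gF f) L) (x : B) :
    IsRicciRelation 𝓘(ℝ, E') b' gF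
      (fun y => J1 𝓘(ℝ, E) b gB f (Fintype.card ι') (L · 3) (L · 4) (L · 5) (x, y))
      (fun y => J2 𝓘(ℝ, E) b gB f (Fintype.card ι') (L · 1) (L · 2) (L · 3) (L · 4) (L · 5)
        (x, y))
      (fun y => ricciRelationCoeff b gB f (Fintype.card ι') L (x, y)) where
  smooth := by
    have hLx : ContMDiff 𝓘(ℝ, E') 𝓘(ℝ, Fin 6 → ℝ) ∞ fun y => L (x, y) :=
      hL.smooth.comp (contMDiff_const.prodMk contMDiff_id)
    have hJ₁ : ContDiff ℝ ∞ fun v : Fin 6 → ℝ =>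
        J1 𝓘(ℝ, E) b gB f (Fintype.card ι') (fun _ => v 3) (fun _ => v 4) (fun _ => v 5)
          (x, ()) := by
      simp only [J1]
      fun_prop
    have hJ₂ : ContDiff ℝ ∞ fun v : Fin 6 → ℝ =>
        J2 𝓘(ℝ, E) b gB f (Fintype.card ι') (fun _ => v 1) (fun _ => v 2) (fun _ => v 3)
          (fun _ => v 4) (fun _ => v 5) (x, ()) := by
      simp only [J2]
      fun_prop
    have hJ₃ : ContDiff ℝ ∞ fun v : Fin 6 → ℝ =>
        ricciRelationCoeff b gB f (Fintype.card ι') (fun _ => v) (x, ()) := by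
      simp only [ricciRelationCoeff]
      fun_prop
    exact ⟨hJ₁.comp_contMDiff hLx, hJ₂.comp_contMDiff hLx, hJ₃.comp_contMDiff hLx⟩
  eq_zero e' he' y hy := by
    have hx := H.ne_zero x
    ext i j
    have hij := congrFun₂ (H.fiber_ricci_relation_at hL x he' hy rfl rfl rfl) i j
    simp only [J1, J2, ricciRelationCoeff, Matrix.add_apply, Matrix.smul_apply, smul_eq_mul,
      Matrix.zero_apply] at hij ⊢
    field_simp at hij ⊢
    linear_combination hij

theorem fiber_isConformallyFlat (H : IsWarpedProduct b b' gB gF f)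
    (hL : IsRoterExpansion (𝓘(ℝ, E).prod 𝓘(ℝ, E')) (b.prod b')
      (warpedMetric 𝓘(ℝ, E) 𝓘(ℝ, E') gB gF f) L) {x : B} {J₁ J₂ : F → ℝ} {Q : ℝ}
    (hJ₁ : J₁ = fun y => J1 𝓘(ℝ, E) b gB f (Fintype.card ι') (L · 3) (L · 4) (L · 5) (x, y))
    (hJ₂ : J₂ = fun y =>
      J2 𝓘(ℝ, E) b gB f (Fintype.card ι') (L · 1) (L · 2) (L · 3) (L · 4) (L · 5) (x, y))
    (hQ : Q = scalarQ 𝓘(ℝ, E) b gB f (Fintype.card ι') x) (hJ₁0 : ∀ y, J₁ y ≠ 0)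
    (h : ∀ y, J₂ y ^ 2 * L (x, y) 5 / (f x ^ 2 * J₁ y ^ 2)
      - J₂ y * (f x * L (x, y) 4 + 4 * L (x, y) 5 * Q) / (f x ^ 2 * J₁ y)
      + 2 * Q * (f x * L (x, y) 4 + 2 * L (x, y) 5 * Q) / f x ^ 2 + L (x, y) 2 = 0) :
    IsConformallyFlat 𝓘(ℝ, E') b' gF := by
  subst hJ₁ hJ₂ hQ
  refine (H.fiber_ricciRelation hL x).isConformallyFlat hJ₁0 (H.fiber_roterExpansion hL x)
    fun y => ?_
  rw [← mul_right_inj' (H.ne_zero x), mul_zero, ← h y]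
  exact mul_quadraticCoeff_fiberCoeff_two (H.ne_zero x) (hJ₁0 y) _ _ _ _ _

theorem base_roterExpansion {α β γ : B → ℝ} (H : IsWarpedProduct b b' gB gF f)
    (hL : IsRoterExpansion (𝓘(ℝ, E).prod 𝓘(ℝ, E')) (b.prod b')
      (warpedMetric 𝓘(ℝ, E) 𝓘(ℝ, E') gB gF f) L)
    (hα : IsScalar 𝓘(ℝ, E) α) (hβ : IsScalar 𝓘(ℝ, E) β) (hγ : IsScalar 𝓘(ℝ, E) γ)
    (hα0 : ∀ x, α x ≠ 0)
    (hT : ∀ e ∈ atlas E B, ∀ x ∈ e.source, α x • tAt 𝓘(ℝ, E) b gB f e x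
      + β x • gAt 𝓘(ℝ, E) b gB e x + γ x • sAt 𝓘(ℝ, E) b gB e x = 0) (y : F) :
    IsRoterExpansion 𝓘(ℝ, E) b gB fun x => affineCoeff (1 + Fintype.card ι' * -(γ x / α x))
      (Fintype.card ι' * -(β x / α x)) (L (x, y)) where
  smooth := contDiff_affineCoeff.comp_contMDiff
    ((contMDiff_const.add (contMDiff_const.mul (hγ.neg_div hα hα0))).prodMk_space
      ((contMDiff_const.mul (hβ.neg_div hα hα0)).prodMk_space
        (hL.smooth.comp (contMDiff_id.prodMk contMDiff_const))))
  riem_eq e he x hx := by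
    have he' := chart_mem_atlas E' y
    have hy := mem_chart_source E' y
    have hz := Set.mk_mem_prod (extend_mem_target hx) (extend_mem_target hy)
    have W := H.isWarpedOn he he'
    have hS : sAt 𝓘(ℝ, E) b gB e x + (Fintype.card ι' : ℝ) • tAt 𝓘(ℝ, E) b gB f e x
        = (1 + Fintype.card ι' * -(γ x / α x)) • sAt 𝓘(ℝ, E) b gB e x
          + (Fintype.card ι' * -(β x / α x)) • gAt 𝓘(ℝ, E) b gB e x := by
      ext i j
      have hij := congrFun₂ (hT e he x hx) i j
      simp only [Matrix.add_apply, Matrix.smul_apply, smul_eq_mul, Matrix.zero_apply] at hij ⊢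
      have := hα0 x
      field_simp
      linear_combination Fintype.card ι' * hij
    ext i j k l
    have hR := congrFun (congrFun (congrFun (congrFun
      (hL.riem_blockMetric he he' hx hy rfl) (Sum.inl i)) (Sum.inl j)) (Sum.inl k)) (Sum.inl l)
    rw [W.riem_base b b' hz, W.ricci_blockMetric b b' hz, W.roterExpr_base _ _ _ hz] at hR
    rw [← roterExpr_smul_add_smul (H.base.isUnit_det_gAt he hx), ← hS]
    exact hR

end IsWarpedProduct

end WarpedProduct

end WarpedGRT

end

open WarpedGRT in
theorem corollary5p1_general
    {ι ι' E E' B F : Type*} [Fintype ι] [DecidableEq ι] [Fintype ι'] [DecidableEq ι']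
    [NormedAddCommGroup E] [NormedSpace ℝ E] [NormedAddCommGroup E'] [NormedSpace ℝ E']
    [TopologicalSpace B] [ChartedSpace E B] [IsManifold 𝓘(ℝ, E) ∞ B] [Nonempty B]
    [TopologicalSpace F] [ChartedSpace E' F] [IsManifold 𝓘(ℝ, E') ∞ F] [ConnectedSpace F]
    {b : Basis ι ℝ E} {b' : Basis ι' ℝ E'} {m : ℕ} (hm : Fintype.card ι' = m)
    {gB : FormField 𝓘(ℝ, E) B} (hgB : IsSemiRiemannian _ b gB)
    {gF : FormField 𝓘(ℝ, E') F} (hgF : IsSemiRiemannian _ b' gF)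
    {f : B → ℝ} (hf : IsScalar 𝓘(ℝ, E) f) (hf0 : ∀ x, f x ≠ 0)
    {L₁ L₂ L₃ L₄ L₅ L₆ : B × F → ℝ}
    (hL : ∀ L ∈ [L₁, L₂, L₃, L₄, L₅, L₆], IsScalar (𝓘(ℝ, E).prod 𝓘(ℝ, E')) L)
    (hR : IsGRTWith _ (b.prod b') (warpedMetric _ _ gB gF f) L₁ L₂ L₃ L₄ L₅ L₆)
    {J₁ J₂ : B × F → ℝ} {Q : B → ℝ}
    (hJ₁ : J₁ = J1 _ b gB f m L₄ L₅ L₆) (hJ₂ : J₂ = J2 _ b gB f m L₂ L₃ L₄ L₅ L₆)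
    (hQ : Q = scalarQ _ b gB f m) :
    IsGRT _ b' gF ∧
    (∀ x : B, (∀ y : F, J₁ (x, y) ≠ 0) →
      IsRoter _ b' gF ∧
      IsEin2 _ b' gF) ∧
    (∀ x : B, (∀ y : F, J₁ (x, y) ≠ 0 ∧
        J₂ (x, y) ^ 2 * L₆ (x, y) / (f x ^ 2 * J₁ (x, y) ^ 2)
          - J₂ (x, y) * (f x * L₅ (x, y) + 4 * L₆ (x, y) * Q x) / (f x ^ 2 * J₁ (x, y))
          + 2 * Q x * (f x * L₅ (x, y) + 2 * L₆ (x, y) * Q x) / f x ^ 2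
          + L₃ (x, y) = 0) →
      IsConformallyFlat _ b' gF ∧
      (3 ≤ m → WeylVanishes _ b' gF)) ∧
    (∀ x : B, (∀ y : F, J₁ (x, y) = 0 ∧ J₂ (x, y) ≠ 0) →
      HasPointwiseConstantCurvature _ b' gF ∧
      (m ≠ 2 → HasConstantCurvature _ b' gF) ∧
      IsEinstein _ b' gF) ∧
    (DependentT _ b gB f →
      IsGRT _ b gB) := by
  subst hm hJ₁ hJ₂ hQ
  have H : IsWarpedProduct b b' gB gF f := ⟨hgB, hgF, hf, hf0⟩
  have hexp := hR.isRoterExpansion hL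
  have hfiber := H.fiber_roterExpansion hexp
  have hrel := H.fiber_ricciRelation hexp
  refine ⟨(hfiber (Classical.arbitrary B)).isGRT,
    fun x hJ => ⟨(hrel x).isRoter hJ (hfiber x), (hrel x).isEin2 hJ⟩,
    fun x hJ => ?_, fun x hJ => ?_, ?_⟩
  · have hflat : IsConformallyFlat _ b' gF :=
      H.fiber_isConformallyFlat hexp rfl rfl rfl (fun y => (hJ y).1) fun y => (hJ y).2
    exact ⟨hflat, hflat.weylVanishes hgF⟩
  · have hpc := (hrel x).hasPointwiseConstantCurvature hgF (fun y => (hJ y).1)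
      (fun y => (hJ y).2) (hfiber x)
    exact ⟨hpc, hpc.hasConstantCurvature_of_card_ne_two hgF,
      (hrel x).isEinstein hgF (fun y => (hJ y).1) fun y => (hJ y).2⟩
  · rintro ⟨α, β, γ, ⟨hα, hβ, hγ⟩, hα0, hT⟩
    exact (H.base_roterExpansion hexp hα hβ hγ hα0 hT (Classical.arbitrary F)).isGRT

theorem corollary5p1
    (p m : ℕ) (hp : 1 ≤ p) (hm : 1 ≤ m)
    {B F : Type*}
    [TopologicalSpace B] [ChartedSpace (EuclideanSpace ℝ (Fin p)) B]
    [IsManifold 𝓘(ℝ, EuclideanSpace ℝ (Fin p)) ∞ B] [ConnectedSpace B]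
    [TopologicalSpace F] [ChartedSpace (EuclideanSpace ℝ (Fin m)) F]
    [IsManifold 𝓘(ℝ, EuclideanSpace ℝ (Fin m)) ∞ F] [ConnectedSpace F]
    (gB : WarpedGRT.FormField 𝓘(ℝ, EuclideanSpace ℝ (Fin p)) B)
    (hgB : WarpedGRT.IsSemiRiemannian _ (WarpedGRT.stdBasis p) gB)
    (gF : WarpedGRT.FormField 𝓘(ℝ, EuclideanSpace ℝ (Fin m)) F)
    (hgF : WarpedGRT.IsSemiRiemannian _ (WarpedGRT.stdBasis m) gF)
    (f : B → ℝ) (hf : WarpedGRT.IsScalar 𝓘(ℝ, EuclideanSpace ℝ (Fin p)) f)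
    (hf_pos : ∀ x, 0 < f x)
    (L₁ L₂ L₃ L₄ L₅ L₆ : B × F → ℝ)
    (hL : ∀ L ∈ [L₁, L₂, L₃, L₄, L₅, L₆], WarpedGRT.IsScalar
      (𝓘(ℝ, EuclideanSpace ℝ (Fin p)).prod 𝓘(ℝ, EuclideanSpace ℝ (Fin m))) L)
    (hR : WarpedGRT.IsGRTWith _ ((WarpedGRT.stdBasis p).prod (WarpedGRT.stdBasis m))
      (WarpedGRT.warpedMetric _ _ gB gF f) L₁ L₂ L₃ L₄ L₅ L₆)
    (J₁ J₂ : B × F → ℝ) (Q : B → ℝ)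
    (hJ₁ : J₁ = WarpedGRT.J1 _ (WarpedGRT.stdBasis p) gB f m L₄ L₅ L₆)
    (hJ₂ : J₂ = WarpedGRT.J2 _ (WarpedGRT.stdBasis p) gB f m L₂ L₃ L₄ L₅ L₆)
    (hQ : Q = WarpedGRT.scalarQ _ (WarpedGRT.stdBasis p) gB f m) :
    -- the fiber is of generalized Roter type
    WarpedGRT.IsGRT _ (WarpedGRT.stdBasis m) gF ∧
    -- the fiber is of Roter type and satisfies the second Einstein-type condition
    (∀ x : B, (∀ y : F, J₁ (x, y) ≠ 0) →
      WarpedGRT.IsRoter _ (WarpedGRT.stdBasis m) gF ∧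
      WarpedGRT.IsEin2 _ (WarpedGRT.stdBasis m) gF) ∧
    -- the fiber is conformally flat
    (∀ x : B, (∀ y : F, J₁ (x, y) ≠ 0 ∧
        J₂ (x, y) ^ 2 * L₆ (x, y) / (f x ^ 2 * J₁ (x, y) ^ 2)
          - J₂ (x, y) * (f x * L₅ (x, y) + 4 * L₆ (x, y) * Q x) / (f x ^ 2 * J₁ (x, y))
          + 2 * Q x * (f x * L₅ (x, y) + 2 * L₆ (x, y) * Q x) / f x ^ 2
          + L₃ (x, y) = 0) →
      WarpedGRT.IsConformallyFlat _ (WarpedGRT.stdBasis m) gF ∧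
      (3 ≤ m → WarpedGRT.WeylVanishes _ (WarpedGRT.stdBasis m) gF)) ∧
    -- the fiber is of constant curvature and Einstein
    (∀ x : B, (∀ y : F, J₁ (x, y) = 0 ∧ J₂ (x, y) ≠ 0) →
      WarpedGRT.HasPointwiseConstantCurvature _ (WarpedGRT.stdBasis m) gF ∧
      (m ≠ 2 → WarpedGRT.HasConstantCurvature _ (WarpedGRT.stdBasis m) gF) ∧
      WarpedGRT.IsEinstein _ (WarpedGRT.stdBasis m) gF) ∧
    -- the base is of generalized Roter type
    (WarpedGRT.DependentT _ (WarpedGRT.stdBasis p) gB f →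
      WarpedGRT.IsGRT _ (WarpedGRT.stdBasis p) gB) :=
  corollary5p1_general (Fintype.card_fin m) hgB hgF hf (fun x => (hf_pos x).ne') hL hR hJ₁ hJ₂ hQ
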